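/- Let $K$ be an algebraically closed field of arbitrary characteristic. A branch $C:\{f=0\}$ is the ideal generated by an irreducible power series $f\in K[[x,y]]$; its multiplicity is $m(C)=\operatorname{ord} f$, the intersection number of two branches $C:\{f=0\}$, $D:\{h=0\}$ is $(C,D)_0=(f,h)_0=\dim_K K[[x,y]]/(f,h)$, and their order of contact is $d(C,D)=\frac{(C,D)_0}{m(C)\,m(D)}\in[0,+\infty]$. The semigroup of $C$ is $\Gamma(C)=\{(f,h)_0 : h\in K[[x,y]],\ h\not\equiv 0 \ (\mathrm{mod}\ f)\}$. We write $\Gamma(C)=\langle v_0,\dots,v_g\rangle$ if $v_0=\min(\Gamma(C)\setminus\{0\})$, $v_k=\min\big(\Gamma(C)\setminus(\mathbb N v_0+\dots+\mathbb N v_{k-1})\big)$ for $1\le k\le g$, and $\Gamma(C)=\mathbb N v_0+\dots+\mathbb N v_g$. Put $e_k=\gcd(v_0,\dots,v_k)$ for $0\le k\le g$. The Zariski pairs of $C$ are the $g$ pairs $\left(\frac{v_k}{e_k},\frac{e_{k-1}}{e_k}\right)$, $1\le k\le g$. For $k\ge 1$ let $\mathcal B_k$ be the family of branches having at most $k-1$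 Zariski pairs, and let $d_k(C)=\sup\{d(C,W): W\in\mathcal B_k\}$. **Proposition.** Let $C$ be a branch with $\Gamma(C)=\langle v_0,\dots,v_g\rangle$. Then, for every $k$ with $1\le k\le g$, $$d_k(C)=\frac{e_{k-1}\,v_k}{v_0^{\,2}},\qquad e_{k-1}=\gcd(v_0,\dots,v_{k-1}).$$ -/

import Mathlib

noncomputable section

namespace PlaneCurve

/-- The ring `K[[x, y]]`. A branch is the principal ideal `(f)` of an irreducible `f`; below it is
represented by such an equation `f`, and all notions depend on `f` only through `(f)`. -/
abbrev Series (K : Type*) [Field K] : Type _ := MvPowerSeries (Fin 2) K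

/-- The intersection number `(f, g)₀ = dim_K K[[x, y]] / (f, g)`, possibly `∞`. -/
def intersectionNumber {K : Type*} [Field K] (f g : Series K) : ℕ∞ :=
  Cardinal.toENat (Module.rank K (Series K ⧸ (Ideal.span {f, g} : Ideal (Series K))))

/-- The multiplicity `m(C) = ord f` of `C : {f = 0}`. -/
def multiplicity {K : Type*} [Field K] (f : Series K) : ℕ∞ := MvPowerSeries.order f

/-- The order of contact `d(C, D) = (C, D)₀ / (m(C) m(D))` of two branches. -/
def contact {K : Type*} [Field K] (f g : Series K) : ENNReal :=
  (intersectionNumber f g : ENNReal) / ((multiplicity f : ENNReal) * (multiplicity g : ENNReal))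

/-- The semigroup `Γ(f) = {(f, h)₀ : h ≢ 0 mod f}` of the branch `f = 0`. -/
def semigroup {K : Type*} [Field K] (f : Series K) : Set ℕ :=
  {n | ∃ h : Series K, ¬ f ∣ h ∧ intersectionNumber f h = (n : ℕ∞)}

/-- `S = ⟨v₀, …, v_g⟩`: `(v₀, …, v_g)` is the minimal system of generators of `S`.
Only the values `v i` with `i ≤ g` matter. -/
structure IsMinimalGenerators (S : Set ℕ) (g : ℕ) (v : ℕ → ℕ) : Prop where
  isLeast_zero : IsLeast (S \ {0}) (v 0)
  isLeast : ∀ k, 1 ≤ k → k ≤ g →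
    IsLeast (S \ (AddSubmonoid.closure (v '' Set.Iio k) : Set ℕ)) (v k)
  eq_closure : S = (AddSubmonoid.closure (v '' Set.Iic g) : Set ℕ)

/-- `e_k = gcd (v₀, …, v_k)`. -/
def gcdUpTo (v : ℕ → ℕ) (k : ℕ) : ℕ := (Finset.range (k + 1)).gcd v

/-- The Zariski pairs `(m_k, n_k) = (v_k / e_k, e_{k-1} / e_k)`, `k = 1, …, g`, listed in order. -/
def zariskiPairs (g : ℕ) (v : ℕ → ℕ) : List (ℕ × ℕ) :=
  (List.range g).map fun i =>
    (v (i + 1) / gcdUpTo v (i + 1), gcdUpTo v i / gcdUpTo v (i + 1))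

/-- The family `ℬ_k` of (equations of) branches having at most `k - 1` Zariski pairs. -/
def branchFamily (K : Type*) [Field K] (k : ℕ) : Set (Series K) :=
  {h | Irreducible h ∧ ∃ (g : ℕ) (v : ℕ → ℕ),
    IsMinimalGenerators (semigroup h) g v ∧ (zariskiPairs g v).length ≤ k - 1}

/-- The `k`-th order contact exponent `d_k(C) = sup {d(C, W) : W ∈ ℬ_k}` of a branch `C`,
meaningful for `k ≥ 1`. -/
def contactExponent {K : Type*} [Field K] (k : ℕ) (f : Series K) : ENNReal :=
  sSup (contact f '' branchFamily K k)

end PlaneCurve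

end

/-! In coordinates transversal to the branch, Weierstrass preparation replaces `f` by a
distinguished polynomial `P` in `K[[x]][y]` of degree `N = v₀`. The intersection number with `f`
becomes `ν(h) = ord_x` of the norm of `h` from `K[[x]][y]/(P)` to `K[[x]]` (`branchVal`). This is a
valuation because, by Hensel's lemma, elements whose norm has nonnegative order are integral. Its
residue field is `K`, so of two elements with equal finite value one can be corrected by a constant
multiple of the other to increase its value.

Write `e_i = gcd(v₀, …, v_i)`. A MacLane type construction produces key polynomials: `φ_i` is monic
of degree `N / e_i` with maximal value among such polynomials. Large multiples of `e_i` are values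
of polynomials of smaller degree, so by maximality `ν(φ_i)` is not a multiple of `e_i`. Consequently
`φ_i`-adic expansions of bounded length have no cancellation, and the values in the next degree
range lie in the monoid generated so far together with `ν(φ_i)`. The gcd drops until it is 1, and
`ν(φ_i) = v_{i+1}` with `e_i v_{i+1}` strictly increasing. No parametrization by Puiseux series is
used, so the characteristic plays no role (`KeySeq.exists_extend`, `KeySeq.isLeast`,
`KeySeq.eq_generators`).

The contact of `P` and `φ_i` is `v_{i+1} / (N · N / e_i) = e_i v_{i+1} / N²`. The strong triangle
inequality (`branchVal_mul_natDegree_eq`) says that if `Q` is closer to `P` than `R` is, then `P`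
and `Q` have the same contact with `R`. Hence key polynomials of `P` that have smaller contact with
`P` than `Q` are key polynomials of `Q`, with proportional values (`KeySeq.transfer_branchVal`).

Lower bound: `φ_{k-1}` inherits `φ_0, …, φ_{k-2}` as a complete key sequence, so it defines a branch
with `k - 1` Zariski pairs, and its contact is the claimed value. Upper bound: a branch with larger
contact would inherit `φ_0, …, φ_{k-1}` and so have at least `k` Zariski pairs. -/

noncomputable section

namespace PlaneCurve

open Polynomial (C X)

/-! ### Weierstrass preparation and Hensel's lemma over `K[[x]]` -/

section Weierstrass

variable {K : Type*} [Field K]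

instance isAdicComplete_maximalIdeal :
    IsAdicComplete (IsLocalRing.maximalIdeal (PowerSeries K)) (PowerSeries K) := by
  rw [PowerSeries.maximalIdeal_eq_span_X]; infer_instance

theorem mem_maximalIdeal_iff (a : PowerSeries K) :
    a ∈ IsLocalRing.maximalIdeal (PowerSeries K) ↔ PowerSeries.constantCoeff a = 0 := by
  rw [PowerSeries.maximalIdeal_eq_span_X, Ideal.mem_span_singleton, PowerSeries.X_dvd_iff]

theorem residue_eq_zero_iff (a : PowerSeries K) :
    IsLocalRing.residue (PowerSeries K) a = 0 ↔ PowerSeries.constantCoeff a = 0 := by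
  rw [IsLocalRing.residue_eq_zero_iff, mem_maximalIdeal_iff]

theorem order_map_residue_toNat {Q : PowerSeries (PowerSeries K)} {n : ℕ}
    (hn : PowerSeries.constantCoeff (PowerSeries.coeff n Q) ≠ 0)
    (hlt : ∀ i < n, PowerSeries.constantCoeff (PowerSeries.coeff i Q) = 0) :
    (PowerSeries.map (IsLocalRing.residue (PowerSeries K)) Q).order = n := by
  rw [PowerSeries.order_eq_nat]
  simp only [PowerSeries.coeff_map, ne_eq, residue_eq_zero_iff]
  exact ⟨hn, hlt⟩

/-- Divisibility of polynomials by a distinguished polynomial can be tested in power series. -/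
theorem dvd_of_coe_dvd_coe {A : Type*} [CommRing A] [IsLocalRing A]
    [IsAdicComplete (IsLocalRing.maximalIdeal A) A] {W Q : Polynomial A}
    (hW : W.IsDistinguishedAt (IsLocalRing.maximalIdeal A))
    (h : (W : PowerSeries A) ∣ Q) : W ∣ Q := by
  have := hW.algEquivQuotient.injective
  rw [← Ideal.Quotient.eq_zero_iff_dvd]
  apply this
  rw [map_zero, Polynomial.IsDistinguishedAt.algEquivQuotient_apply]
  exact (Ideal.Quotient.eq_zero_iff_dvd _ _).2 h

/-- Weierstrass preparation for a power series which has order `n` modulo `x`. -/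
theorem exists_distinguished {Q : PowerSeries (PowerSeries K)} {n : ℕ}
    (hn : PowerSeries.constantCoeff (PowerSeries.coeff n Q) ≠ 0)
    (hlt : ∀ i < n, PowerSeries.constantCoeff (PowerSeries.coeff i Q) = 0) :
    ∃ (W : Polynomial (PowerSeries K)) (U : PowerSeries (PowerSeries K)),
      W.IsDistinguishedAt (IsLocalRing.maximalIdeal (PowerSeries K)) ∧ IsUnit U ∧
        Q = W * U ∧ W.natDegree = n := by
  have ho := order_map_residue_toNat hn hlt
  have h0 : PowerSeries.map (IsLocalRing.residue (PowerSeries K)) Q ≠ 0 := by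
    intro h
    rw [h, PowerSeries.order_zero] at ho
    exact absurd ho (by simp)
  obtain ⟨W, U, h⟩ := PowerSeries.exists_isWeierstrassFactorization h0
  refine ⟨W, U, h.isDistinguishedAt, h.isUnit, h.eq_mul, ?_⟩
  rw [h.natDegree_eq_toNat_order_map, ho]
  simp

/-- A polynomial which is nonzero modulo `x` is divisible by a distinguished polynomial of
degree equal to its order modulo `x`. -/
theorem exists_distinguished_dvd {Q : Polynomial (PowerSeries K)} {n : ℕ}
    (hn : PowerSeries.constantCoeff (Q.coeff n) ≠ 0)
    (hlt : ∀ i < n, PowerSeries.constantCoeff (Q.coeff i) = 0) :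
    ∃ W : Polynomial (PowerSeries K),
      W.IsDistinguishedAt (IsLocalRing.maximalIdeal (PowerSeries K)) ∧ W ∣ Q ∧
        W.natDegree = n := by
  obtain ⟨W, U, hW, -, hQ, hd⟩ := exists_distinguished
    (Q := (Q : PowerSeries (PowerSeries K))) (n := n) (by simpa using hn) (by simpa using hlt)
  exact ⟨W, hW, dvd_of_coe_dvd_coe hW ⟨U, hQ⟩, hd⟩

/-- A consequence of Hensel's lemma: a monic irreducible polynomial over `K((x))` with integral
constant term has integral coefficients. -/
theorem exists_map_eq_of_irreducible {p : Polynomial (LaurentSeries K)} (hp : p.Monic)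
    (hirr : Irreducible p)
    (h0 : ∃ a : PowerSeries K, algebraMap _ (LaurentSeries K) a = p.coeff 0) :
    ∃ P : Polynomial (PowerSeries K), P.map (algebraMap _ (LaurentSeries K)) = p := by
  classical
  have hinj : Function.Injective (algebraMap (PowerSeries K) (LaurentSeries K)) :=
    IsFractionRing.injective _ _
  have hex : ∃ (s : ℕ) (P : Polynomial (PowerSeries K)), P.map (algebraMap _ (LaurentSeries K)) =
      algebraMap _ (LaurentSeries K) ((PowerSeries.X : PowerSeries K) ^ s) • p := by
    obtain ⟨b, hb, h⟩ := IsLocalization.integerNormalization_spec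
      (nonZeroDivisors (PowerSeries K)) p
    have hb0 : b ≠ 0 := nonZeroDivisors.ne_zero hb
    obtain ⟨s, u, hu⟩ := IsDiscreteValuationRing.associated_pow_irreducible hb0
      (PowerSeries.X_prime (R := K)).irreducible
    refine ⟨s, C (u : PowerSeries K) *
      IsLocalization.integerNormalization (nonZeroDivisors (PowerSeries K)) p, ?_⟩
    rw [Polynomial.map_mul, h, ← hu, Polynomial.map_C, ← Polynomial.smul_eq_C_mul,
      ← algebraMap_smul (LaurentSeries K) b p, smul_smul, map_mul, mul_comm]
  -- The least power of `x` that clears the denominators of `p`; the claim amounts to `s = 0`. If `s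
  -- > 0`, then `P`, which is `x ^ s p`, is nonzero modulo `x` by minimality.
  let s := Nat.find hex
  obtain ⟨P, hP⟩ : ∃ P : Polynomial (PowerSeries K), P.map (algebraMap _ (LaurentSeries K)) =
      algebraMap _ (LaurentSeries K) ((PowerSeries.X : PowerSeries K) ^ s) • p := Nat.find_spec hex
  have hPc (i : ℕ) : algebraMap _ (LaurentSeries K) (P.coeff i) =
      algebraMap _ (LaurentSeries K) ((PowerSeries.X : PowerSeries K) ^ s) * p.coeff i := by
    rw [← Polynomial.coeff_map, hP, Polynomial.coeff_smul, smul_eq_mul]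
  rcases Nat.eq_zero_or_pos s with hs | hs
  · exact ⟨P, by simpa [hs] using hP⟩
  exfalso
  have hX0 : algebraMap _ (LaurentSeries K) ((PowerSeries.X : PowerSeries K)) ≠ 0 := by
    rw [Ne, map_eq_zero_iff _ hinj]; exact PowerSeries.X_ne_zero
  have hne : ∃ i, PowerSeries.constantCoeff (P.coeff i) ≠ 0 := by
    by_contra! hall
    have : C (PowerSeries.X : PowerSeries K) ∣ P := by
      rw [Polynomial.C_dvd_iff_dvd_coeff]
      exact fun i => PowerSeries.X_dvd_iff.2 (hall i)
    obtain ⟨P', rfl⟩ := this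
    refine Nat.find_min hex (m := s - 1) (by change s - 1 < s; omega) ⟨P', ?_⟩
    obtain ⟨t, ht⟩ : ∃ t, s = t + 1 := ⟨s - 1, by omega⟩
    rw [ht] at hP ⊢
    rw [Polynomial.map_mul, Polynomial.map_C, ← Polynomial.smul_eq_C_mul, pow_succ', map_mul,
      mul_smul] at hP
    exact smul_right_injective _ hX0 hP
  have hdeg : p.natDegree = P.natDegree := by
    rw [← Polynomial.natDegree_map_eq_of_injective hinj P, hP, Polynomial.natDegree_smul]
    simp
  let n := Nat.find hne
  have hn : PowerSeries.constantCoeff (P.coeff n) ≠ 0 := Nat.find_spec hne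
  have hX : PowerSeries.constantCoeff ((PowerSeries.X : PowerSeries K) ^ s) = 0 := by
    simp [hs.ne']
  -- Both the constant and the leading coefficient of `P` are divisible by `x`, so its order `n`
  -- modulo `x` lies strictly between 0 and the degree. The distinguished factor `W` of degree `n`
  -- then contradicts irreducibility.
  obtain ⟨W, hW, hdvd, hWd⟩ := exists_distinguished_dvd hn
    (fun i hi => not_not.1 (Nat.find_min hne hi))
  have hn0 : n ≠ 0 := by
    intro h
    apply hn
    obtain ⟨a, ha⟩ := h0
    have := hPc 0
    rw [← ha, ← map_mul] at this
    rw [h, hinj this, map_mul, hX, zero_mul]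
  have hnd : n < p.natDegree := by
    have h1 : n ≤ P.natDegree := Polynomial.le_natDegree_of_ne_zero (fun h => hn (by simp [h]))
    refine lt_of_le_of_ne (hdeg ▸ h1) fun h => hn ?_
    have := hPc n
    rw [h, hp.coeff_natDegree, mul_one] at this
    rw [h, hinj this, hX]
  have hdvd' : W.map (algebraMap _ (LaurentSeries K)) ∣ p := by
    have := Polynomial.map_dvd (algebraMap _ (LaurentSeries K)) hdvd
    rw [hP, Polynomial.smul_eq_C_mul] at this
    refine this.trans (Associated.dvd ?_)
    refine associated_unit_mul_left _ _ (Polynomial.isUnit_C.2 (IsUnit.mk0 _ ?_))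
    simp
  have hWm : (W.map (algebraMap _ (LaurentSeries K))).natDegree = n := by
    rw [hW.monic.natDegree_map, hWd]
  rcases hirr.dvd_iff.1 hdvd' with h | h
  · exact hn0 (by rw [← hWm]; exact Polynomial.natDegree_eq_zero_of_isUnit h)
  · have := Polynomial.natDegree_eq_of_degree_eq (Polynomial.degree_eq_degree_of_associated h)
    omega

end Weierstrass

/-! ### Extending the order of `K((x))` to finite extensions -/

section Extension

variable {K : Type*} [Field K]

theorem addVal_algebraMap_nonneg (a : PowerSeries K) :
    0 ≤ HahnSeries.addVal ℤ K (algebraMap _ (LaurentSeries K) a) := by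
  rcases eq_or_ne (algebraMap _ (LaurentSeries K) a) 0 with ha | ha
  · simp [ha]
  rw [HahnSeries.addVal_apply_of_ne ha]
  have h := mt HahnSeries.coeff_order_eq_zero.1 ha
  rw [LaurentSeries.coe_algebraMap] at h ⊢
  rw [PowerSeries.coeff_coe] at h
  by_contra! hlt
  rw [if_pos (by exact_mod_cast hlt)] at h
  exact h rfl

theorem exists_algebraMap_eq {y : LaurentSeries K} (hy : 0 ≤ HahnSeries.addVal ℤ K y) :
    ∃ a : PowerSeries K, algebraMap _ (LaurentSeries K) a = y := by
  refine ⟨PowerSeries.mk fun n => y.coeff n, ?_⟩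
  ext i
  rw [LaurentSeries.coe_algebraMap, PowerSeries.coeff_coe]
  split_ifs with hi
  · by_contra hne
    have := hy.trans (HahnSeries.addVal_le_of_coeff_ne_zero (Ne.symm hne))
    exact absurd hi (not_lt.2 (by exact_mod_cast this))
  · rw [PowerSeries.coeff_mk, Int.natAbs_of_nonneg (not_lt.1 hi)]

theorem addVal_algebraMap_X_pow (n : ℕ) :
    HahnSeries.addVal ℤ K (algebraMap _ (LaurentSeries K) ((PowerSeries.X : PowerSeries K) ^ n)) =
      ((n : ℤ) : WithTop ℤ) := by
  rw [LaurentSeries.coe_algebraMap, HahnSeries.ofPowerSeries_X_pow, HahnSeries.addVal_apply,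
    HahnSeries.orderTop_single one_ne_zero]

variable (K) (L : Type*) [Field L] [Algebra (LaurentSeries K) L]
  [FiniteDimensional (LaurentSeries K) L]

variable {K L} in
theorem norm_eq_coeff_zero_minpoly (z : L) : ∃ (n r : ℕ), 0 < r ∧
    Algebra.norm (LaurentSeries K) z =
      ((-1) ^ n * (minpoly (LaurentSeries K) z).coeff 0) ^ r := by
  have hz : IsIntegral (LaurentSeries K) z := Algebra.IsIntegral.isIntegral z
  refine ⟨(IntermediateField.adjoin.powerBasis hz).dim,
    Module.finrank (IntermediateField.adjoin (LaurentSeries K) {z}) L, Module.finrank_pos, ?_⟩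
  rw [Algebra.norm_eq_norm_adjoin]
  congr 1
  have := Algebra.PowerBasis.norm_gen_eq_coeff_zero_minpoly (IntermediateField.adjoin.powerBasis hz)
  rw [IntermediateField.adjoin.powerBasis_gen, IntermediateField.minpoly_gen] at this
  exact this

theorem addVal_norm_eq (z : L) : ∃ r : ℕ, 0 < r ∧
    HahnSeries.addVal ℤ K (Algebra.norm (LaurentSeries K) z) =
      r • HahnSeries.addVal ℤ K ((minpoly (LaurentSeries K) z).coeff 0) := by
  obtain ⟨n, r, hr, h⟩ := norm_eq_coeff_zero_minpoly (K := K) z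
  refine ⟨r, hr, ?_⟩
  rw [h, AddValuation.map_pow, AddValuation.map_mul, AddValuation.map_pow, AddValuation.map_neg,
    AddValuation.map_one]
  simp

theorem nonneg_of_nsmul_nonneg {x : WithTop ℤ} {r : ℕ} (hr : 0 < r) (h : 0 ≤ r • x) : 0 ≤ x := by
  by_contra! hx
  exact absurd h (not_le.2 (by
    induction x using WithTop.recTopCoe with
    | top => simp at hx
    | coe x =>
      have hx : x < 0 := by exact_mod_cast hx
      have : r • (x : WithTop ℤ) = ((r • x : ℤ) : WithTop ℤ) := rfl
      rw [this, ← WithTop.coe_zero, WithTop.coe_lt_coe, nsmul_eq_mul]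
      exact mul_neg_of_pos_of_neg (by exact_mod_cast hr) hx))

variable {K} in
-- The norm is, up to sign, a power of the constant term of the minimal polynomial. If that term is
-- integral, Hensel's lemma makes the whole minimal polynomial integral. Conversely, norms of
-- integral elements are integral because `K[[x]]` is integrally closed.
theorem addVal_norm_nonneg_iff [Algebra (PowerSeries K) L]
    [IsScalarTower (PowerSeries K) (LaurentSeries K) L] (z : L) :
    0 ≤ HahnSeries.addVal ℤ K (Algebra.norm (LaurentSeries K) z) ↔
      IsIntegral (PowerSeries K) z := by
  constructor
  · intro h
    obtain ⟨r, hr, h'⟩ := addVal_norm_eq K L z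
    rw [h'] at h
    have hz : IsIntegral (LaurentSeries K) z := Algebra.IsIntegral.isIntegral z
    obtain ⟨P, hP⟩ := exists_map_eq_of_irreducible (minpoly.monic hz) (minpoly.irreducible hz)
      (exists_algebraMap_eq (nonneg_of_nsmul_nonneg hr h))
    refine ⟨P, ?_, ?_⟩
    · have := minpoly.monic hz
      rw [← hP] at this
      exact Polynomial.monic_of_injective (IsFractionRing.injective _ _) this
    · rw [IsScalarTower.algebraMap_eq (PowerSeries K) (LaurentSeries K) L,
        ← Polynomial.eval₂_map, hP]
      exact minpoly.aeval _ z
  · intro h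
    obtain ⟨a, ha⟩ := IsIntegrallyClosed.isIntegral_iff.1
      (Algebra.isIntegral_norm (LaurentSeries K) h)
    rw [← ha]
    exact addVal_algebraMap_nonneg a

/-- The (unnormalized) extension of the order function of `K((x))` to a finite extension. -/
def extVal : AddValuation L (WithTop ℤ) := AddValuation.of
  (fun z => HahnSeries.addVal ℤ K (Algebra.norm (LaurentSeries K) z))
  (by simp [Algebra.norm_zero]) (by simp)
  (by
    let _ : Algebra (PowerSeries K) L := ((algebraMap (LaurentSeries K) L).comp
      (algebraMap (PowerSeries K) (LaurentSeries K))).toAlgebra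
    have : IsScalarTower (PowerSeries K) (LaurentSeries K) L := IsScalarTower.of_algebraMap_eq' rfl
    -- Dividing by the element of smaller value reduces the ultrametric inequality to `1 + z` with
    -- `z` of nonnegative value. There it says that integral elements are closed under addition.
    have key (a b : L) (hab : HahnSeries.addVal ℤ K (Algebra.norm (LaurentSeries K) a) ≤
        HahnSeries.addVal ℤ K (Algebra.norm (LaurentSeries K) b)) :
        HahnSeries.addVal ℤ K (Algebra.norm (LaurentSeries K) a) ≤
          HahnSeries.addVal ℤ K (Algebra.norm (LaurentSeries K) (a + b)) := by
      rcases eq_or_ne a 0 with rfl | ha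
      · simpa using hab
      obtain ⟨z, rfl⟩ : ∃ z, b = a * z := ⟨a⁻¹ * b, by field_simp⟩
      have hna : HahnSeries.addVal ℤ K (Algebra.norm (LaurentSeries K) a) ≠ ⊤ := by
        rw [Ne, AddValuation.top_iff, Algebra.norm_eq_zero_iff]; exact ha
      have hz : 0 ≤ HahnSeries.addVal ℤ K (Algebra.norm (LaurentSeries K) z) := by
        rw [map_mul, AddValuation.map_mul] at hab
        by_contra! h
        exact absurd hab (not_le.2 (by simpa using WithTop.add_lt_add_left hna h))
      have h1 : 0 ≤ HahnSeries.addVal ℤ K (Algebra.norm (LaurentSeries K) (1 + z)) := by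
        rw [addVal_norm_nonneg_iff] at hz ⊢
        exact isIntegral_one.add hz
      rw [show a + a * z = a * (1 + z) by ring, map_mul, AddValuation.map_mul]
      exact le_add_of_nonneg_right h1
    intro a b
    rcases le_total (HahnSeries.addVal ℤ K (Algebra.norm (LaurentSeries K) a))
      (HahnSeries.addVal ℤ K (Algebra.norm (LaurentSeries K) b)) with h | h
    · rw [min_eq_left h]; exact key a b h
    · rw [min_eq_right h, add_comm]; exact key b a h)
  (by intro a b; simp)

theorem extVal_apply (z : L) :
    extVal K L z = HahnSeries.addVal ℤ K (Algebra.norm (LaurentSeries K) z) := rfl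

theorem extVal_algEquiv (σ : L ≃ₐ[LaurentSeries K] L) (z : L) :
    extVal K L (σ z) = extVal K L z := by
  rw [extVal_apply, extVal_apply, Algebra.norm_eq_of_algEquiv]

/-- The residue field of the extension is `K`. -/
theorem exists_extVal_sub_pos [IsAlgClosed K] (z : L) (hz : 0 ≤ extVal K L z) :
    ∃ c : K, 0 < extVal K L
      (z - algebraMap _ L (algebraMap _ (LaurentSeries K) (PowerSeries.C c))) := by
  have hzi : IsIntegral (LaurentSeries K) z := Algebra.IsIntegral.isIntegral z
  obtain ⟨r, hr, h'⟩ := addVal_norm_eq K L z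
  rw [extVal_apply, h'] at hz
  obtain ⟨P, hP⟩ := exists_map_eq_of_irreducible (minpoly.monic hzi) (minpoly.irreducible hzi)
      (exists_algebraMap_eq (nonneg_of_nsmul_nonneg hr hz))
  have hPm : P.Monic := by
    have := minpoly.monic hzi
    rw [← hP] at this
    exact Polynomial.monic_of_injective (IsFractionRing.injective _ _) this
  -- The residue `c` is a root of the minimal polynomial reduced modulo `x`. The minimal polynomial
  -- of `z - c` has constant term `P(c)`, which is then divisible by `x`.
  obtain ⟨c, hc⟩ := IsAlgClosed.exists_root (P.map (PowerSeries.constantCoeff (R := K))) (by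
    rw [hPm.degree_map, ← Polynomial.degree_map_eq_of_injective
      (IsFractionRing.injective (PowerSeries K) (LaurentSeries K)), hP]
    exact (minpoly.degree_pos hzi).ne')
  refine ⟨c, ?_⟩
  obtain ⟨q, hq, h⟩ := addVal_norm_eq K L
    (z - algebraMap _ L (algebraMap _ (LaurentSeries K) (PowerSeries.C c)))
  rw [extVal_apply, h, minpoly.sub_algebraMap, Polynomial.coeff_zero_eq_eval_zero,
    Polynomial.eval_comp]
  simp only [Polynomial.eval_add, Polynomial.eval_X, Polynomial.eval_C, zero_add]
  rw [← hP, Polynomial.eval_map_algebraMap, Polynomial.aeval_algebraMap_apply]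
  have h0 : PowerSeries.constantCoeff (P.eval (PowerSeries.C c)) = 0 := by
    rw [Polynomial.IsRoot, Polynomial.eval_map] at hc
    rw [← hc, Polynomial.eval, Polynomial.hom_eval₂]
    simp
  obtain ⟨a, ha⟩ := PowerSeries.X_dvd_iff.2 h0
  rw [Polynomial.coe_aeval_eq_eval, ha, map_mul, AddValuation.map_mul, ← pow_one PowerSeries.X,
    addVal_algebraMap_X_pow]
  have := addVal_algebraMap_nonneg a
  rw [nsmul_pos_iff hq.ne']
  exact lt_of_lt_of_le (by simp) (le_add_of_nonneg_right this)

end Extension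

/-! ### The valuation of a branch -/

section BranchValuation

variable {K : Type*} [Field K]

/-- The inclusion of `ℕ ∪ {∞}` in `ℤ ∪ {∞}`. -/
def natToInt (n : ℕ∞) : WithTop ℤ := WithTop.map (fun n : ℕ => (n : ℤ)) n

@[simp] theorem natToInt_top : natToInt ⊤ = ⊤ := rfl

@[simp] theorem natToInt_coe (n : ℕ) : natToInt n = ((n : ℤ) : WithTop ℤ) := rfl

theorem natToInt_le_iff (m n : ℕ∞) : natToInt m ≤ natToInt n ↔ m ≤ n :=
  WithTop.map_le_iff (fun n : ℕ => (n : ℤ)) (by simp)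

theorem natToInt_lt_iff (m n : ℕ∞) : natToInt m < natToInt n ↔ m < n := by
  rw [← not_le, natToInt_le_iff, not_le]

theorem addVal_algebraMap (a : PowerSeries K) :
    HahnSeries.addVal ℤ K (algebraMap _ (LaurentSeries K) a) =
      natToInt a.order := by
  rcases eq_or_ne a 0 with rfl | ha
  · rw [map_zero, AddValuation.map_zero, PowerSeries.order_zero, natToInt_top]
  obtain ⟨n, u, hu⟩ := IsDiscreteValuationRing.associated_pow_irreducible ha
      (PowerSeries.X_prime (R := K)).irreducible
  have hunit (u : (PowerSeries K)ˣ) :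
      HahnSeries.addVal ℤ K (algebraMap _ (LaurentSeries K) (u : PowerSeries K)) = 0 := by
    refine le_antisymm ?_ (addVal_algebraMap_nonneg _)
    have h1 : HahnSeries.addVal ℤ K (algebraMap _ (LaurentSeries K) (u : PowerSeries K)) +
      HahnSeries.addVal ℤ K
        (algebraMap _ (LaurentSeries K) ((u⁻¹ : (PowerSeries K)ˣ) : PowerSeries K)) = 0 := by
      rw [← AddValuation.map_mul, ← map_mul, Units.mul_inv, map_one, AddValuation.map_one]
    calc _ ≤ _ := le_add_of_nonneg_right
          (addVal_algebraMap_nonneg ((u⁻¹ : (PowerSeries K)ˣ) : PowerSeries K))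
      _ = 0 := h1
  have ho : a.order = n := by
    have := PowerSeries.order_mul a (u : PowerSeries K)
    rw [hu, PowerSeries.order_X_pow, PowerSeries.order_zero_of_unit u.isUnit, add_zero] at this
    exact this.symm
  have := congrArg (fun a => HahnSeries.addVal ℤ K (algebraMap _ (LaurentSeries K) a)) hu
  simp only [map_mul, AddValuation.map_mul, hunit, add_zero] at this
  rw [this, addVal_algebraMap_X_pow, ho, natToInt_coe]

theorem powerBasisAux'_apply {R : Type*} [CommRing R] {P : Polynomial R} (hP : P.Monic)
    (j : Fin P.natDegree) :
    AdjoinRoot.powerBasisAux' hP j = AdjoinRoot.root P ^ (j : ℕ) := by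
  rw [← AdjoinRoot.powerBasis'_gen hP]
  exact (AdjoinRoot.powerBasis' hP).basis_eq_pow j

/-- The powers of the root form a basis on both sides, and reduction modulo a monic polynomial
commutes with base change, so the multiplication matrices correspond. -/
theorem norm_adjoinRoot_map {R F : Type*} [CommRing R] [CommRing F] [Nontrivial F] [Algebra R F]
    {P : Polynomial R} (hP : P.Monic) (h : Polynomial R) :
    Algebra.norm F (AdjoinRoot.mk (P.map (algebraMap R F)) (h.map (algebraMap R F))) =
      algebraMap R F (Algebra.norm R (AdjoinRoot.mk P h)) := by
  have hP' := hP.map (algebraMap R F)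
  let b := AdjoinRoot.powerBasisAux' hP
  let b' := (AdjoinRoot.powerBasisAux' hP').reindex (finCongr (hP.natDegree_map (algebraMap R F)))
  rw [Algebra.norm_eq_matrix_det b, Algebra.norm_eq_matrix_det b', RingHom.map_det]
  congr 1
  ext i j
  rw [Algebra.leftMulMatrix_eq_repr_mul, RingHom.mapMatrix_apply, Matrix.map_apply,
    Algebra.leftMulMatrix_eq_repr_mul]
  have hb : b j = AdjoinRoot.mk P (X ^ (j : ℕ)) := by
    simp [b, powerBasisAux'_apply]
  have hb' : b' j = AdjoinRoot.mk (P.map (algebraMap R F)) (X ^ (j : ℕ)) := by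
    simp [b', powerBasisAux'_apply]
  rw [hb, hb', ← map_mul, ← map_mul]
  simp only [b, b', Module.Basis.repr_reindex, Finsupp.mapDomain_equiv_apply,
    AdjoinRoot.powerBasisAux'_repr_apply_to_fun, AdjoinRoot.modByMonicHom_mk]
  rw [← Polynomial.coeff_map, Polynomial.map_modByMonic _ hP]
  simp

theorem irreducible_map_laurent {P : Polynomial (PowerSeries K)} (hP : P.Monic)
    (hirr : Irreducible P) : Irreducible (P.map (algebraMap _ (LaurentSeries K))) :=
  hP.irreducible_iff_irreducible_map_fraction_map.1 hirr

/-- The function `h ↦ ord_x N(h)`, where `N` is the norm of `K[[x]][y]/(P)` over `K[[x]]`. -/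
def normOrder (P h : Polynomial (PowerSeries K)) : ℕ∞ :=
  (Algebra.norm (PowerSeries K) (AdjoinRoot.mk P h)).order

theorem extVal_mk_eq_normOrder {P : Polynomial (PowerSeries K)} (hP : P.Monic)
    [Fact (Irreducible (P.map (algebraMap _ (LaurentSeries K))))]
    [FiniteDimensional (LaurentSeries K) (AdjoinRoot (P.map (algebraMap _ (LaurentSeries K))))]
    (h : Polynomial (PowerSeries K)) :
    extVal K (AdjoinRoot (P.map (algebraMap _ (LaurentSeries K))))
      (AdjoinRoot.mk _ (h.map (algebraMap _ (LaurentSeries K)))) =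
      natToInt (normOrder P h) := by
  rw [extVal_apply, norm_adjoinRoot_map hP, addVal_algebraMap]
  rfl

theorem finiteDimensional_adjoinRoot_map {P : Polynomial (PowerSeries K)} (hP : P.Monic) :
    FiniteDimensional (LaurentSeries K) (AdjoinRoot (P.map (algebraMap _ (LaurentSeries K)))) :=
  (hP.map (algebraMap _ (LaurentSeries K))).finite_adjoinRoot

/-- The valuation of the branch `P = 0` on `K[[x]][y]`. -/
def branchVal (P : Polynomial (PowerSeries K)) (hP : P.Monic) (hirr : Irreducible P) :
    AddValuation (Polynomial (PowerSeries K)) ℕ∞ :=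
  AddValuation.of (normOrder P)
    (by
      have : Nontrivial (AdjoinRoot P) := AdjoinRoot.nontrivial P
        (hP.degree_pos_of_not_isUnit hirr.not_isUnit).ne'
      have := hP.free_adjoinRoot
      have := hP.finite_adjoinRoot
      rw [normOrder, map_zero, Algebra.norm_zero, PowerSeries.order_zero])
    (by rw [normOrder, map_one, map_one, PowerSeries.order_one])
    (by
      have := Fact.mk (irreducible_map_laurent hP hirr)
      have := finiteDimensional_adjoinRoot_map hP
      intro a b
      rw [min_le_iff]
      have := (extVal K (AdjoinRoot (P.map (algebraMap _ (LaurentSeries K))))).map_add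
        (AdjoinRoot.mk _ (a.map (algebraMap _ (LaurentSeries K))))
        (AdjoinRoot.mk _ (b.map (algebraMap _ (LaurentSeries K))))
      rw [← map_add, ← Polynomial.map_add, extVal_mk_eq_normOrder hP, extVal_mk_eq_normOrder hP,
        extVal_mk_eq_normOrder hP, min_le_iff, natToInt_le_iff, natToInt_le_iff] at this
      exact this)
    (by
      intro a b
      rw [normOrder, map_mul, map_mul, PowerSeries.order_mul]; rfl)

section Properties

variable {P : Polynomial (PowerSeries K)} (hP : P.Monic) (hirr : Irreducible P)

theorem branchVal_apply (h : Polynomial (PowerSeries K)) :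
    branchVal P hP hirr h = (Algebra.norm (PowerSeries K) (AdjoinRoot.mk P h)).order := rfl

theorem extVal_mk_eq_branchVal
    [Fact (Irreducible (P.map (algebraMap _ (LaurentSeries K))))]
    [FiniteDimensional (LaurentSeries K) (AdjoinRoot (P.map (algebraMap _ (LaurentSeries K))))]
    (h : Polynomial (PowerSeries K)) :
    extVal K (AdjoinRoot (P.map (algebraMap _ (LaurentSeries K))))
      (AdjoinRoot.mk _ (h.map (algebraMap _ (LaurentSeries K)))) =
      natToInt (branchVal P hP hirr h) :=
  extVal_mk_eq_normOrder hP h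

include hirr in
theorem isDomain_adjoinRoot : IsDomain (AdjoinRoot P) :=
  AdjoinRoot.isDomain_of_prime hirr.prime

theorem branchVal_C (a : PowerSeries K) :
    branchVal P hP hirr (C a) = P.natDegree • a.order := by
  have : IsDomain (AdjoinRoot P) := isDomain_adjoinRoot hirr
  rw [branchVal_apply, AdjoinRoot.mk_C, ← AdjoinRoot.algebraMap_eq,
    Algebra.norm_algebraMap_of_basis (AdjoinRoot.powerBasisAux' hP), PowerSeries.order_pow]
  simp

theorem branchVal_C_X :
    branchVal P hP hirr (C PowerSeries.X) = P.natDegree := by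
  rw [branchVal_C, PowerSeries.order_X]; simp

theorem branchVal_eq_top_iff (h : Polynomial (PowerSeries K)) :
    branchVal P hP hirr h = ⊤ ↔ P ∣ h := by
  have := isDomain_adjoinRoot hirr
  have := hP.free_adjoinRoot
  have := hP.finite_adjoinRoot
  rw [branchVal_apply, PowerSeries.order_eq_top, Algebra.norm_eq_zero_iff, AdjoinRoot.mk_eq_zero]

/-- Over `K((x))` the quotient `a / b` makes sense and has value 0; `c` is its residue. -/
theorem exists_branchVal_lt_sub [IsAlgClosed K] {a b : Polynomial (PowerSeries K)}
    (hab : branchVal P hP hirr a = branchVal P hP hirr b) (hb : branchVal P hP hirr b ≠ ⊤) :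
    ∃ c : K, branchVal P hP hirr b <
      branchVal P hP hirr (a - C (PowerSeries.C c) * b) := by
  have := Fact.mk (irreducible_map_laurent hP hirr)
  have := finiteDimensional_adjoinRoot_map hP
  let L := AdjoinRoot (P.map (algebraMap _ (LaurentSeries K)))
  let m (h : Polynomial (PowerSeries K)) : L :=
    AdjoinRoot.mk _ (h.map (algebraMap _ (LaurentSeries K)))
  have hm (h) : extVal K L (m h) = natToInt (branchVal P hP hirr h) :=
    extVal_mk_eq_branchVal hP hirr h
  obtain ⟨n, hn⟩ := ENat.ne_top_iff_exists.1 hb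
  have hmb : m b ≠ 0 := by
    intro h0
    have := hm b
    rw [h0, AddValuation.map_zero, ← hn] at this
    exact absurd this (by simp)
  have hz : extVal K L (m a / m b) = 0 := by
    have h1 : extVal K L (m a) = extVal K L (m a / m b) + extVal K L (m b) := by
      rw [← AddValuation.map_mul, div_mul_cancel₀ _ hmb]
    rw [hm, hm, hab, ← hn, natToInt_coe] at h1
    exact (WithTop.add_right_inj (z := ((n : ℤ) : WithTop ℤ)) (by simp)).1
      (by rw [zero_add]; exact h1.symm)
  obtain ⟨c, hc⟩ := exists_extVal_sub_pos K L (m a / m b) hz.ge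
  refine ⟨c, ?_⟩
  have h2 : m (a - C (PowerSeries.C c) * b) = (m a / m b -
      algebraMap _ L (algebraMap _ (LaurentSeries K) (PowerSeries.C c))) * m b := by
    rw [sub_mul, div_mul_cancel₀ _ hmb]
    simp only [m, Polynomial.map_sub, Polynomial.map_mul, Polynomial.map_C, map_sub, map_mul,
      AdjoinRoot.mk_C]
    rfl
  rw [← natToInt_lt_iff, ← hm, ← hm, h2, AddValuation.map_mul]
  have h3 : extVal K L (m b) ≠ ⊤ := by rw [hm, ← hn]; simp
  calc extVal K L (m b) = 0 + extVal K L (m b) := (zero_add _).symm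
    _ < _ := WithTop.add_lt_add_right h3 hc

end Properties

/-! ### Dimensions of quotients as orders of norms -/

section Dimension

theorem finrank_quotient_span {a : PowerSeries K} (ha : a ≠ 0) :
    Module.Finite K (PowerSeries K ⧸ Ideal.span {a}) ∧
      (Module.finrank K (PowerSeries K ⧸ Ideal.span {a}) : ℕ∞) = a.order := by
  obtain ⟨n, hn⟩ := IsDiscreteValuationRing.associated_pow_irreducible ha
      (PowerSeries.X_prime (R := K)).irreducible
  have ho : a.order = n := by
    obtain ⟨u, hu⟩ := hn
    have := PowerSeries.order_mul a (u : PowerSeries K)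
    rw [hu, PowerSeries.order_X_pow, PowerSeries.order_zero_of_unit u.isUnit, add_zero] at this
    exact this.symm
  rw [ho, Ideal.span_singleton_eq_span_singleton.2 hn]
  let T : PowerSeries K →ₗ[K] (Fin n → K) := LinearMap.pi fun i => PowerSeries.coeff (i : ℕ)
  have hT : Function.Surjective T := by
    intro v
    refine ⟨PowerSeries.mk fun i => if h : i < n then v ⟨i, h⟩ else 0, ?_⟩
    ext i
    simp [T]
  have hker : LinearMap.ker T =
      (Ideal.span {(PowerSeries.X : PowerSeries K) ^ n}).restrictScalars K := by
    ext f
    rw [LinearMap.mem_ker, Submodule.restrictScalars_mem, Ideal.mem_span_singleton,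
      PowerSeries.X_pow_dvd_iff]
    constructor
    · intro h m hm
      exact congrFun h ⟨m, hm⟩
    · intro h
      ext i
      exact h i i.2
  let e : (PowerSeries K ⧸ Ideal.span {(PowerSeries.X : PowerSeries K) ^ n}) ≃ₗ[K] (Fin n → K) :=
    (Submodule.quotEquivOfEq _ _ hker.symm).trans (T.quotKerEquivOfSurjective hT)
  refine ⟨Module.Finite.equiv e.symm, ?_⟩
  rw [e.finrank_eq]; simp

/-- By the Smith normal form of the ideal `(s)`, the quotient is a product of rings `K[[x]]/(a_i)`,
each of dimension `ord a_i`, while the norm of `s` is a unit times the product of the `a_i`. -/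
theorem toENat_rank_quotient_norm {S : Type*} [CommRing S] [IsDomain S] [Algebra (PowerSeries K) S]
    [Algebra K S] [IsScalarTower K (PowerSeries K) S] {ι : Type*} [Fintype ι]
    (b : Module.Basis ι (PowerSeries K) S) {s : S} (hs : s ≠ 0) :
    Cardinal.toENat (Module.rank K (S ⧸ Ideal.span {s})) =
      (Algebra.norm (PowerSeries K) s).order := by
  have h := Ideal.span_singleton_eq_bot.not.2 hs
  have hfin (i : ι) := finrank_quotient_span (Ideal.smithCoeffs_ne_zero b _ h i)
  have := fun i => (hfin i).1
  have e := (Ideal.quotientEquivPiSpan _ b h).restrictScalars K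
  have : Module.Finite K (S ⧸ Ideal.span {s}) := Module.Finite.equiv e.symm
  obtain ⟨u, hu⟩ := (associated_norm_prod_smith b hs)
  have ho : (Algebra.norm (PowerSeries K) s).order =
      (∏ i, Ideal.smithCoeffs b _ h i).order := by
    rw [← hu, PowerSeries.order_mul, PowerSeries.order_zero_of_unit u.isUnit, add_zero]
  rw [ho, PowerSeries.order_prod, ← Module.finrank_eq_rank, Cardinal.toENat_nat, e.finrank_eq,
    Module.finrank_pi_fintype, Nat.cast_sum]
  exact Finset.sum_congr rfl fun i _ => (hfin i).2

theorem toENat_rank_quotient_eq_branchVal {P : Polynomial (PowerSeries K)} (hP : P.Monic)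
    (hirr : Irreducible P) {h : Polynomial (PowerSeries K)} (hh : ¬ P ∣ h) :
    Cardinal.toENat (Module.rank K
      (Polynomial (PowerSeries K) ⧸ (Ideal.span {P, h} : Ideal (Polynomial (PowerSeries K))))) =
      branchVal P hP hirr h := by
  have := isDomain_adjoinRoot hirr
  rw [branchVal_apply, ← toENat_rank_quotient_norm (AdjoinRoot.powerBasisAux' hP)
    (fun h0 => hh (AdjoinRoot.mk_eq_zero.1 h0))]
  have e1 := DoubleQuot.quotQuotEquivQuotSupₐ K (Ideal.span {P}) (Ideal.span {h})
  have e2 : (Ideal.span {h}).map (Ideal.Quotient.mkₐ K (Ideal.span {P})) =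
      Ideal.span {AdjoinRoot.mk P h} := by
    rw [Ideal.map_span, Set.image_singleton]; rfl
  have e3 : (Ideal.span {P, h} : Ideal (Polynomial (PowerSeries K))) =
      Ideal.span {P} ⊔ Ideal.span {h} := Ideal.span_insert _ _
  rw [e3, ← e2]
  exact congrArg _ e1.symm.toLinearEquiv.rank_eq

end Dimension

end BranchValuation

/-! ### The strong triangle inequality for roots in a normal extension -/

section StrongTriangle

theorem AddValuation_map_multiset_prod {R Γ : Type*} [CommRing R]
    [LinearOrderedAddCommMonoidWithTop Γ] (V : AddValuation R Γ) (s : Multiset R) :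
    V s.prod = (s.map V).sum := by
  induction s using Multiset.induction with
  | empty => simp
  | cons a s ih => simp [ih]

variable {F L Γ : Type*} [Field F] [Field L] [Algebra F L] [Normal F L]
  [LinearOrderedAddCommMonoidWithTop Γ] (V : AddValuation L Γ)

omit [Normal F L] in
theorem map_aeval_eq_sum {p : Polynomial F} (hp : p.Monic)
    (hs : (p.map (algebraMap F L)).Splits) (x : L) :
    V (Polynomial.aeval x p) =
      ((p.map (algebraMap F L)).roots.map fun a => V (x - a)).sum := by
  rw [← Polynomial.eval_map_algebraMap, hs.eval_eq_prod_roots, (hp.map _).leadingCoeff, one_mul,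
    AddValuation_map_multiset_prod, Multiset.map_map]
  rfl

theorem exists_algEquiv_of_roots {p : Polynomial F} (hp : p.Monic) (hirr : Irreducible p)
    {a b : L} (ha : Polynomial.aeval a p = 0) (hb : Polynomial.aeval b p = 0) :
    ∃ σ : L ≃ₐ[F] L, σ a = b := by
  have h : IsConjRoot F b a := by
    rw [isConjRoot_def, ← minpoly.eq_of_irreducible_of_monic hirr ha hp,
      ← minpoly.eq_of_irreducible_of_monic hirr hb hp]
  exact h.exists_algEquiv

theorem map_aeval_eq_of_roots (hV : ∀ (σ : L ≃ₐ[F] L) z, V (σ z) = V z) {p : Polynomial F}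
    (hp : p.Monic) (hirr : Irreducible p) {a b : L} (ha : Polynomial.aeval a p = 0)
    (hb : Polynomial.aeval b p = 0) (h : Polynomial F) :
    V (Polynomial.aeval a h) = V (Polynomial.aeval b h) := by
  obtain ⟨σ, rfl⟩ := exists_algEquiv_of_roots hp hirr ha hb
  rw [← hV σ (Polynomial.aeval a h), Polynomial.aeval_algEquiv, AlgHom.comp_apply]
  rfl

omit [Normal F L] in
theorem exists_root_forall_le {p : Polynomial F} {c : L} (hc : Polynomial.aeval c p = 0)
    (hp : p.Monic) (x : L) : ∃ b : L, Polynomial.aeval b p = 0 ∧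
      ∀ c : L, Polynomial.aeval c p = 0 → V (x - c) ≤ V (x - b) := by
  classical
  have hmem (c : L) : c ∈ (p.map (algebraMap F L)).roots.toFinset ↔ Polynomial.aeval c p = 0 := by
    rw [Multiset.mem_toFinset, Polynomial.mem_roots (hp.map _).ne_zero, Polynomial.IsRoot,
      Polynomial.eval_map_algebraMap]
  obtain ⟨b, hb, h⟩ := Finset.exists_max_image (p.map (algebraMap F L)).roots.toFinset
    (fun c => V (x - c)) ⟨c, (hmem c).2 hc⟩
  exact ⟨b, (hmem b).1 hb, fun c hc => h c ((hmem c).2 hc)⟩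

/-- The strong triangle inequality for the contact of irreducible polynomials. -/
theorem map_aeval_eq_of_lt (hV : ∀ (σ : L ≃ₐ[F] L) z, V (σ z) = V z) {f w g : Polynomial F}
    (hf : f.Monic) (hw : w.Monic) (hg : g.Monic) (hfi : Irreducible f) (hwi : Irreducible w)
    (hgi : Irreducible g) (hfs : (f.map (algebraMap F L)).Splits)
    (hgs : (g.map (algebraMap F L)).Splits) {α β γ : L} (hα : Polynomial.aeval α f = 0)
    (hβ : Polynomial.aeval β w = 0) (hγ : Polynomial.aeval γ g = 0)
    (hlt : V (Polynomial.aeval γ f) < V (Polynomial.aeval β f)) :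
    V (Polynomial.aeval α g) = V (Polynomial.aeval β g) := by
  obtain ⟨b, hb, hbmax⟩ := exists_root_forall_le V hβ hw α
  obtain ⟨c, hc, hcmax⟩ := exists_root_forall_le V hγ hg α
  rw [map_aeval_eq_of_roots V hV hw hwi hβ hb] at hlt ⊢
  rw [map_aeval_eq_of_roots V hV hg hgi hγ hc] at hlt
  -- Here `b` and `c` are the conjugates of `β` and `γ` nearest to `α`. If `c` were at least as near
  -- as `b`, it would be at least as near as `b` to every conjugate of `α`, contradicting `hlt`
  -- after summation over the roots of `f`.
  have key : V (α - c) < V (α - b) := by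
    by_contra! hle
    refine absurd hlt (not_lt.2 ?_)
    rw [map_aeval_eq_sum V hf hfs, map_aeval_eq_sum V hf hfs]
    apply Multiset.sum_map_le_sum_map
    intro a ha
    rw [Polynomial.mem_roots (hf.map _).ne_zero, Polynomial.IsRoot,
      Polynomial.eval_map_algebraMap] at ha
    obtain ⟨σ, rfl⟩ := exists_algEquiv_of_roots hf hfi hα ha
    have h1 : V (b - σ α) ≤ V (α - b) := by
      obtain ⟨b', rfl⟩ := σ.surjective b
      rw [← map_sub, hV, V.map_sub_swap]
      refine hbmax b' ?_
      rw [Polynomial.aeval_algEquiv, AlgHom.comp_apply] at hb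
      exact (map_eq_zero_iff _ σ.injective).1 hb
    rcases lt_or_ge (V (α - σ α)) (V (α - b)) with h | h
    · have e1 : V (b - σ α) = V (α - σ α) := by
        rw [show b - σ α = (α - σ α) - (α - b) by ring, AddValuation.map_sub_eq_of_lt_left V h]
      have e2 : V (c - σ α) = V (α - σ α) := by
        rw [show c - σ α = (α - σ α) - (α - c) by ring,
          AddValuation.map_sub_eq_of_lt_left V (h.trans_le hle)]
      rw [e1, e2]
    · rw [show c - σ α = (α - σ α) - (α - c) by ring]
      exact (h1.trans (le_min h hle)).trans (V.map_sub _ _)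
  -- Every root `a` of `g` is farther from `α` than `b` is, so `b - a` and `α - a` have the same
  -- value; the two sums agree term by term.
  rw [map_aeval_eq_sum V hg hgs, map_aeval_eq_sum V hg hgs]
  congr 1
  apply Multiset.map_congr rfl
  intro a ha
  rw [Polynomial.mem_roots (hg.map _).ne_zero, Polynomial.IsRoot,
      Polynomial.eval_map_algebraMap] at ha
  rw [show b - a = (α - a) - (α - b) by ring,
    AddValuation.map_sub_eq_of_lt_left V ((hcmax a ha).trans_lt key)]

end StrongTriangle

/-! ### Contact of three irreducible polynomials -/

section Comparison

variable {K : Type*} [Field K]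

/-- `extVal` is not normalized. By transitivity of norms, passing from `K((x))[y]/(P)` to `L`
multiplies values by the relative degree; multiplying through by `deg P` avoids the division. -/
theorem nsmul_extVal_aeval (L : Type*) [Field L] [Algebra (LaurentSeries K) L]
    [FiniteDimensional (LaurentSeries K) L] {P : Polynomial (PowerSeries K)} (hP : P.Monic)
    (hirr : Irreducible P) {α : L}
    (hα : Polynomial.aeval α (P.map (algebraMap _ (LaurentSeries K))) = 0)
    (h : Polynomial (PowerSeries K)) :
    P.natDegree • extVal K L (Polynomial.aeval α (h.map (algebraMap _ (LaurentSeries K)))) =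
      Module.finrank (LaurentSeries K) L • natToInt (branchVal P hP hirr h) := by
  have := Fact.mk (irreducible_map_laurent hP hirr)
  have hfin := finiteDimensional_adjoinRoot_map hP
  let E := AdjoinRoot (P.map (algebraMap _ (LaurentSeries K)))
  let ψ : E →ₐ[LaurentSeries K] L := AdjoinRoot.liftAlgHom _ (Algebra.ofId _ _) α hα
  let _ : Algebra E L := ψ.toRingHom.toAlgebra
  have : IsScalarTower (LaurentSeries K) E L := IsScalarTower.of_algebraMap_eq'
    ψ.comp_algebraMap.symm
  have : FiniteDimensional E L := FiniteDimensional.right (LaurentSeries K) E L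
  have hdeg : Module.finrank (LaurentSeries K) E = P.natDegree := by
    rw [(AdjoinRoot.powerBasis' (hP.map _)).finrank, AdjoinRoot.powerBasis'_dim, hP.natDegree_map]
  have hz : Polynomial.aeval α (h.map (algebraMap _ (LaurentSeries K))) =
      algebraMap E L (AdjoinRoot.mk _ (h.map (algebraMap _ (LaurentSeries K)))) := by
    change _ = ψ _
    exact (AdjoinRoot.liftAlgHom_mk _ _ _ hα _).symm
  rw [hz, extVal_apply, ← Algebra.norm_norm (S := E), Algebra.norm_algebraMap, map_pow,
    AddValuation.map_pow, ← extVal_apply, extVal_mk_eq_branchVal hP hirr, ← mul_nsmul',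
    ← Module.finrank_mul_finrank (LaurentSeries K) E L, hdeg]

theorem natToInt_add (m n : ℕ∞) : natToInt (m + n) = natToInt m + natToInt n :=
  WithTop.map_add (Nat.castAddMonoidHom ℤ) m n

theorem natToInt_nsmul (n : ℕ) (m : ℕ∞) : natToInt (n • m) = n • natToInt m := by
  induction n with
  | zero => simp only [zero_nsmul]; rfl
  | succ n ih => rw [succ_nsmul, succ_nsmul, natToInt_add, ih]

theorem nsmul_enat_lt_nsmul {n : ℕ} (hn : 0 < n) {x y : ℕ∞} (h : x < y) : n • x < n • y := by
  lift x to ℕ using (h.trans_le le_top).ne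
  rw [nsmul_eq_mul, nsmul_eq_mul, ← Nat.cast_mul]
  induction y using ENat.recTopCoe with
  | top => rw [ENat.mul_top (by exact_mod_cast hn.ne')]; exact ENat.natCast_lt_top _
  | coe y =>
    rw [← Nat.cast_mul]
    exact_mod_cast Nat.mul_lt_mul_of_pos_left (by exact_mod_cast h) hn

/-- If the contact of `P` and `Q` exceeds that of `P` and `R`, then `P` and `Q` have the same
contact with `R`. -/
theorem branchVal_mul_natDegree_eq {P Q R : Polynomial (PowerSeries K)} (hP : P.Monic)
    (hQ : Q.Monic) (hR : R.Monic) (hPi : Irreducible P) (hQi : Irreducible Q)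
    (hRi : Irreducible R)
    (hlt : Q.natDegree • branchVal R hR hRi P < R.natDegree • branchVal Q hQ hQi P) :
    P.natDegree • branchVal Q hQ hQi R = Q.natDegree • branchVal P hP hPi R := by
  classical
  let f : Polynomial (LaurentSeries K) := (P * Q * R).map (algebraMap _ (LaurentSeries K))
  -- A common splitting field is normal, so roots of an irreducible factor are conjugate under
  -- automorphisms; separability is not required.
  let L := f.SplittingField
  let m (h : Polynomial (PowerSeries K)) := h.map (algebraMap _ (LaurentSeries K))
  have hf : f = m P * m Q * m R := by simp [f, m, Polynomial.map_mul]
  have hf0 : f ≠ 0 := (((hP.mul hQ).mul hR).map _).ne_zero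
  have hs : (f.map (algebraMap (LaurentSeries K) L)).Splits := Polynomial.SplittingField.splits f
  have hsp {p : Polynomial (LaurentSeries K)} (hd : p ∣ f) :
      (p.map (algebraMap (LaurentSeries K) L)).Splits :=
    hs.of_dvd (Polynomial.map_ne_zero hf0) (Polynomial.map_dvd _ hd)
  have hroot {p : Polynomial (PowerSeries K)} (hp : p.Monic) (hi : Irreducible p)
      (hd : m p ∣ f) : ∃ a : L, Polynomial.aeval a (m p) = 0 := by
    obtain ⟨a, ha⟩ := (hsp hd).exists_eval_eq_zero (by
      rw [Polynomial.degree_map, hp.degree_map]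
      exact (hp.degree_pos_of_not_isUnit hi.not_isUnit).ne')
    exact ⟨a, by rwa [← Polynomial.eval_map_algebraMap]⟩
  have hPd : m P ∣ f := hf ▸ dvd_mul_of_dvd_left (dvd_mul_right _ _) _
  have hQd : m Q ∣ f := hf ▸ dvd_mul_of_dvd_left (dvd_mul_left _ _) _
  have hRd : m R ∣ f := hf ▸ dvd_mul_left _ _
  obtain ⟨α, hα⟩ := hroot hP hPi hPd
  obtain ⟨β, hβ⟩ := hroot hQ hQi hQd
  obtain ⟨γ, hγ⟩ := hroot hR hRi hRd
  have hD : 0 < Module.finrank (LaurentSeries K) L := Module.finrank_pos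
  have h1 : extVal K L (Polynomial.aeval γ (m P)) < extVal K L (Polynomial.aeval β (m P)) := by
    by_contra! hle
    have e1 := nsmul_extVal_aeval L hR hRi hγ P
    have e2 := nsmul_extVal_aeval L hQ hQi hβ P
    have h := nsmul_le_nsmul_right hle (R.natDegree * Q.natDegree)
    rw [mul_nsmul' _ R.natDegree, mul_nsmul _ R.natDegree, e1, e2, ← natToInt_nsmul,
      ← natToInt_nsmul, ← natToInt_nsmul, ← natToInt_nsmul, natToInt_le_iff,
      ← mul_nsmul', ← mul_nsmul', mul_comm R.natDegree, mul_comm Q.natDegree, mul_nsmul',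
      mul_nsmul'] at h
    exact absurd h (not_le.2 (nsmul_enat_lt_nsmul hD hlt))
  have h2 := map_aeval_eq_of_lt (extVal K L) (fun σ z => extVal_algEquiv K L σ z) (hP.map _)
    (hQ.map _) (hR.map _) (irreducible_map_laurent hP hPi) (irreducible_map_laurent hQ hQi)
    (irreducible_map_laurent hR hRi) (hsp hPd) (hsp hRd) hα hβ hγ h1
  have e1 := nsmul_extVal_aeval L hP hPi hα R
  have e2 := nsmul_extVal_aeval L hQ hQi hβ R
  rw [h2] at e1
  have e3 : natToInt (Module.finrank (LaurentSeries K) L •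
      (P.natDegree • branchVal Q hQ hQi R)) = natToInt (Module.finrank (LaurentSeries K) L •
      (Q.natDegree • branchVal P hP hPi R)) := by
    rw [← mul_nsmul', ← mul_nsmul', mul_comm, mul_comm _ Q.natDegree, mul_nsmul', mul_nsmul',
      natToInt_nsmul, natToInt_nsmul, natToInt_nsmul, natToInt_nsmul]
    rw [← e1, ← e2, ← mul_nsmul', ← mul_nsmul', mul_comm]
  have e4 := le_antisymm ((natToInt_le_iff _ _).1 e3.le) ((natToInt_le_iff _ _).1 e3.ge)
  rcases lt_trichotomy (P.natDegree • branchVal Q hQ hQi R)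
    (Q.natDegree • branchVal P hP hPi R) with h | h | h
  · exact absurd e4 (nsmul_enat_lt_nsmul hD h).ne
  · exact h
  · exact absurd e4 (nsmul_enat_lt_nsmul hD h).ne'

end Comparison

/-! ### Values of polynomials of bounded degree -/

section Levels

variable {K : Type*} [Field K]

/-- The properties of the valuation of a branch of degree `N` used to build key polynomials. -/
structure IsBranchVal (ν : AddValuation (Polynomial (PowerSeries K)) ℕ∞) (N : ℕ) : Prop where
  pos : 0 < N
  map_C_X : ν (C PowerSeries.X) = N
  ne_top : ∀ h : Polynomial (PowerSeries K), h ≠ 0 → h.degree < N → ν h ≠ ⊤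
  residue : ∀ a b : Polynomial (PowerSeries K), ν a = ν b → ν b ≠ ⊤ →
    ∃ c : K, ν b < ν (a - C (PowerSeries.C c) * b)
  reduce : ∀ h : Polynomial (PowerSeries K), ν h ≠ ⊤ →
    ∃ r : Polynomial (PowerSeries K), r ≠ 0 ∧ r.degree < N ∧ ν r = ν h

theorem isBranchVal_branchVal [IsAlgClosed K] {P : Polynomial (PowerSeries K)} (hP : P.Monic)
    (hirr : Irreducible P) : IsBranchVal (branchVal P hP hirr) P.natDegree where
  pos := hP.natDegree_pos_of_not_isUnit hirr.not_isUnit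
  map_C_X := branchVal_C_X hP hirr
  ne_top h h0 hd := by
    rw [Ne, branchVal_eq_top_iff]
    intro hdvd
    exact h0 (Polynomial.eq_zero_of_dvd_of_degree_lt hdvd
      (by rwa [Polynomial.degree_eq_natDegree hP.ne_zero]))
  residue a b hab hb := exists_branchVal_lt_sub hP hirr hab hb
  reduce h hh := by
    rw [Ne, branchVal_eq_top_iff, ← Polynomial.modByMonic_eq_zero_iff_dvd hP] at hh
    refine ⟨h %ₘ P, hh, ?_, ?_⟩
    · rw [← Polynomial.degree_eq_natDegree hP.ne_zero]
      exact Polynomial.degree_modByMonic_lt _ hP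
    · rw [branchVal_apply, branchVal_apply]
      congr 2
      rw [AdjoinRoot.mk_eq_mk]
      exact ⟨-(h /ₘ P), by rw [Polynomial.modByMonic_eq_sub_mul_div]; ring⟩

/-- The description of the values `ν h` for polynomials `h` of degree less than `d`: they lie in
the monoid `M`, whose elements are divisible by `e`, and they contain the multiples of `e` which
are at least `c`. -/
structure Level (ν : AddValuation (Polynomial (PowerSeries K)) ℕ∞) (N d e c : ℕ)
    (M : AddSubmonoid ℕ) : Prop where
  mem : ∀ h : Polynomial (PowerSeries K), h ≠ 0 → h.degree < d → ∃ m ∈ M, ν h = (m : ℕ∞)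
  dvd : ∀ m ∈ M, e ∣ m
  surj : ∀ m : ℕ, e ∣ m → c ≤ m →
    ∃ h : Polynomial (PowerSeries K), h.degree < d ∧ ν h = (m : ℕ∞)
  bound : ∃ b : ℕ, ∀ (s : ℕ) (h : Polynomial (PowerSeries K)), h.degree < d →
    ((s * N + b : ℕ) : ℕ∞) ≤ ν h → C (PowerSeries.X ^ s) ∣ h

variable {ν : AddValuation (Polynomial (PowerSeries K)) ℕ∞} {N d e c : ℕ} {M : AddSubmonoid ℕ}

theorem map_eq_zero_of_isUnit {h : Polynomial (PowerSeries K)} (hu : IsUnit h) : ν h = 0 := by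
  obtain ⟨u, rfl⟩ := hu
  have h1 : ν (u : Polynomial (PowerSeries K)) + ν ((u⁻¹ : (Polynomial (PowerSeries K))ˣ) :
      Polynomial (PowerSeries K)) = 0 := by
    rw [← AddValuation.map_mul, Units.mul_inv, AddValuation.map_one]
  exact (add_eq_zero.1 h1).1

theorem level_zero (hν : IsBranchVal ν N) : Level ν N 1 N 0 (AddSubmonoid.closure {N}) := by
  have hC (a : PowerSeries K) (ha : a ≠ 0) : ∃ n : ℕ, ν (C a) = ((n * N : ℕ) : ℕ∞) ∧
      PowerSeries.X ^ n ∣ a := by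
    obtain ⟨n, u, hu⟩ := IsDiscreteValuationRing.associated_pow_irreducible ha
      (PowerSeries.X_prime (R := K)).irreducible
    refine ⟨n, ?_, (Associated.symm ⟨u, hu⟩).dvd⟩
    · have h1 : ν (C a) + ν (C (u : PowerSeries K)) = ν (C (PowerSeries.X ^ n)) := by
        rw [← hu, Polynomial.C_mul, AddValuation.map_mul]
      rw [map_eq_zero_of_isUnit (Polynomial.isUnit_C.2 u.isUnit), add_zero, Polynomial.C_pow,
        AddValuation.map_pow, hν.map_C_X] at h1
      rw [h1]; simp
  have hdeg (h : Polynomial (PowerSeries K)) (hd : h.degree < (1 : ℕ)) : ∃ a, h = C a :=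
    ⟨_, Polynomial.eq_C_of_degree_le_zero (Polynomial.natDegree_eq_zero_iff_degree_le_zero.1 (by
      rcases eq_or_ne h 0 with rfl | h0
      · simp
      · rw [Polynomial.degree_eq_natDegree h0] at hd
        have : h.natDegree < 1 := by exact_mod_cast hd
        omega))⟩
  refine ⟨?_, ?_, ?_, 0, ?_⟩
  · rintro h h0 hd
    obtain ⟨a, rfl⟩ := hdeg h hd
    obtain ⟨n, hn, -⟩ := hC a (by simpa using h0)
    exact ⟨n * N, AddSubmonoid.mem_closure_singleton.2 ⟨n, by simp⟩, hn⟩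
  · intro m hm
    obtain ⟨n, rfl⟩ := AddSubmonoid.mem_closure_singleton.1 hm
    simp
  · rintro _ ⟨n, rfl⟩ -
    refine ⟨C (PowerSeries.X ^ n), ?_, ?_⟩
    · exact lt_of_le_of_lt Polynomial.degree_C_le (by simp)
    · rw [Polynomial.C_pow, AddValuation.map_pow, hν.map_C_X]; simp [mul_comm]
  · intro s h hd hs
    obtain ⟨a, rfl⟩ := hdeg h hd
    rcases eq_or_ne a 0 with rfl | ha
    · simp
    obtain ⟨n, hn, hX⟩ := hC a ha
    rw [hn, add_zero, Nat.cast_le] at hs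
    have := Nat.le_of_mul_le_mul_right hs hν.pos
    exact map_dvd C ((pow_dvd_pow _ this).trans hX)

theorem not_dvd_mul_of_lt_div_gcd {e w i : ℕ} (hi : 0 < i) (hin : i < e / e.gcd w) :
    ¬ e ∣ i * w := by
  intro h
  have he : 0 < e := Nat.pos_of_ne_zero fun h => by simp [h] at hin
  have hg : 0 < e.gcd w := Nat.gcd_pos_of_pos_left _ he
  have h1 : e / e.gcd w ∣ i * (w / e.gcd w) := by
    rw [← Nat.mul_div_assoc _ (Nat.gcd_dvd_right e w)]
    exact Nat.div_dvd_div (Nat.gcd_dvd_left e w) h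
  have := (Nat.coprime_div_gcd_div_gcd hg).dvd_of_dvd_mul_right h1
  exact absurd (Nat.le_of_dvd hi this) (not_le.2 hin)

/-- After division by the gcd, `w` becomes invertible modulo `e / e.gcd w`, which determines `j`.
The lower bound on `m` keeps the subtraction honest. -/
theorem exists_lt_div_gcd_dvd_sub {e w m : ℕ} (he : 0 < e) (hm : e.gcd w ∣ m)
    (hle : e / e.gcd w * w ≤ m) : ∃ j < e / e.gcd w, j * w ≤ m ∧ e ∣ m - j * w := by
  have hg : 0 < e.gcd w := Nat.gcd_pos_of_pos_left _ he
  set n := e / e.gcd w with hn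
  have hn0 : 0 < n := Nat.div_pos (Nat.gcd_le_left _ he) hg
  have : NeZero n := ⟨hn0.ne'⟩
  obtain ⟨m', rfl⟩ := hm
  let u := ZMod.unitOfCoprime (w / e.gcd w) (Nat.coprime_div_gcd_div_gcd hg).symm
  let j := ((m' : ZMod n) * ((u⁻¹ : (ZMod n)ˣ) : ZMod n)).val
  have hj : j < n := ZMod.val_lt _
  have hle' : j * w ≤ e.gcd w * m' := (Nat.mul_le_mul_right _ hj.le).trans hle
  refine ⟨j, hj, hle', ?_⟩
  have h1 : j * (w / e.gcd w) ≡ m' [MOD n] := by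
    rw [← ZMod.natCast_eq_natCast_iff, Nat.cast_mul, ZMod.natCast_zmod_val,
      mul_assoc]
    have h0 : ((u⁻¹ : (ZMod n)ˣ) : ZMod n) * ((w / e.gcd w : ℕ) : ZMod n) = 1 := u.inv_mul
    rw [h0, mul_one]
  have h2 := h1.mul_left' (e.gcd w)
  rw [hn, Nat.mul_div_cancel' (Nat.gcd_dvd_left e w), mul_left_comm,
    Nat.mul_div_cancel' (Nat.gcd_dvd_right e w)] at h2
  exact (Nat.modEq_iff_dvd' hle').1 h2

/-- In the division `h = a + φ q`, the value of `a` is a multiple of `e`, whereas that of `φ q` is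
one plus `i w` with `0 < i < e / gcd(e, w)`, hence not a multiple. The two values differ, nothing
cancels, and `ν h` is their minimum. For the same reason a lower bound on `ν h` passes to both
parts, which gives the divisibility by powers of `x`. -/
theorem Level.expansion (L : Level ν N d e c M) {φ : Polynomial (PowerSeries K)} (hφ : φ.Monic)
    (hφd : φ.natDegree = d) {w b : ℕ} (hw : ν φ = (w : ℕ∞))
    (hb : ∀ (s : ℕ) (h : Polynomial (PowerSeries K)), h.degree < d →
      ((s * N + b : ℕ) : ℕ∞) ≤ ν h → C (PowerSeries.X ^ s) ∣ h)
    (j : ℕ) (hj : j ≤ e / e.gcd w) :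
    ∀ h : Polynomial (PowerSeries K), h.degree < (j * d : ℕ) →
      (h ≠ 0 → ∃ i < j, ∃ m ∈ M, ν h = ((m + i * w : ℕ) : ℕ∞)) ∧
      (∀ s : ℕ, ((s * N + (b + j * w) : ℕ) : ℕ∞) ≤ ν h → C (PowerSeries.X ^ s) ∣ h) := by
  have hφdeg : φ.degree = d := by rw [Polynomial.degree_eq_natDegree hφ.ne_zero, hφd]
  induction j with
  | zero =>
    intro h hd
    have : h = 0 := by
      rw [zero_mul] at hd
      exact Polynomial.degree_eq_bot.1 (Nat.WithBot.lt_zero_iff.1 hd)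
    subst this
    exact ⟨fun h => absurd rfl h, fun _ _ => dvd_zero _⟩
  | succ j ih =>
    intro h hd
    set a := h %ₘ φ with ha
    set q := h /ₘ φ with hq
    have hsum : a + φ * q = h := Polynomial.modByMonic_add_div h φ
    have had : a.degree < d := hφdeg ▸ Polynomial.degree_modByMonic_lt h hφ
    have hqd : q.degree < (j * d : ℕ) := by
      rcases eq_or_ne q 0 with h0 | h0
      · rw [h0, Polynomial.degree_zero]; exact WithBot.bot_lt_coe _
      have h1 : φ.degree ≤ h.degree := by
        by_contra! hlt
        exact h0 ((Polynomial.divByMonic_eq_zero_iff hφ).2 hlt)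
      have h2 := Polynomial.degree_add_divByMonic hφ h1
      rw [← h2, hφdeg, ← hq, Polynomial.degree_eq_natDegree h0] at hd
      rw [Polynomial.degree_eq_natDegree h0]
      norm_cast at hd ⊢
      linarith
    obtain ⟨ih1, ih2⟩ := ih (by omega) q hqd
    have hνq : ν (φ * q) = w + ν q := by rw [AddValuation.map_mul, hw]
    have key : (h ≠ 0 → ∃ i < j + 1, ∃ m ∈ M, ν h = ((m + i * w : ℕ) : ℕ∞)) ∧
        ν h ≤ ν a ∧ ν h ≤ ν (φ * q) := by
      rcases eq_or_ne q 0 with hq0 | hq0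
      · have hha : a = h := by rw [← hsum, hq0, mul_zero, add_zero]
        rw [hq0, mul_zero, AddValuation.map_zero, hha]
        refine ⟨fun h0 => ?_, le_rfl, le_top⟩
        obtain ⟨m, hm, h⟩ := L.mem h h0 (hha ▸ had)
        exact ⟨0, by omega, m, hm, by simpa using h⟩
      obtain ⟨i, hi, m, hm, hqv⟩ := ih1 hq0
      have hqv' : ν (φ * q) = ((m + (i + 1) * w : ℕ) : ℕ∞) := by
        rw [hνq, hqv, ← Nat.cast_add]; congr 1; ring
      rcases eq_or_ne a 0 with ha0 | ha0
      · have hha : φ * q = h := by rw [← hsum, ha0, zero_add]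
        rw [ha0, AddValuation.map_zero, hha]
        exact ⟨fun h0 => ⟨i + 1, by omega, m, hm, hha ▸ hqv'⟩, le_top, le_rfl⟩
      obtain ⟨m', hm', hav⟩ := L.mem a ha0 had
      have hne : m' ≠ m + (i + 1) * w := by
        intro heq
        refine not_dvd_mul_of_lt_div_gcd (e := e) (w := w) (i := i + 1) (by omega) (by omega) ?_
        rw [Nat.dvd_add_right (L.dvd m hm) |>.symm, ← heq]
        exact L.dvd m' hm'
      rcases lt_or_gt_of_ne hne with hlt | hlt
      · have : ν h = ν a := by
          rw [← hsum]
          exact AddValuation.map_add_eq_of_lt_left ν (by rw [hav, hqv']; exact_mod_cast hlt)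
        refine ⟨fun _ => ⟨0, by omega, m', hm', by rw [this, hav]; simp⟩, this.le, ?_⟩
        rw [this, hav, hqv']; exact_mod_cast hlt.le
      · have : ν h = ν (φ * q) := by
          rw [← hsum]
          exact AddValuation.map_add_eq_of_lt_right ν (by rw [hav, hqv']; exact_mod_cast hlt)
        refine ⟨fun _ => ⟨i + 1, by omega, m, hm, by rw [this, hqv']⟩, ?_, this.le⟩
        rw [this, hav, hqv']; exact_mod_cast hlt.le
    obtain ⟨k1, k2, k3⟩ := key
    refine ⟨k1, fun s hs => ?_⟩
    rw [← hsum]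
    apply dvd_add
    · refine hb s a had (le_trans ?_ (hs.trans k2))
      exact_mod_cast (by nlinarith : s * N + b ≤ s * N + (b + (j + 1) * w))
    · refine Dvd.dvd.mul_left (ih2 s ?_) _
      have h3 := hs.trans k3
      rw [hνq, show s * N + (b + (j + 1) * w) = w + (s * N + (b + j * w)) by ring,
        Nat.cast_add] at h3
      exact (ENat.add_le_add_iff_left (ENat.natCast_ne_top w)).1 h3

/-- A large multiple `m` of the new gcd is the value of some `a * φ ^ j`, where `j` solves `j w ≡ m`
modulo `e`. Since `(j + 1) w ≤ m` and `c ≤ w`, the difference `m - j w` is at least `c`, so it is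
the value of a suitable `a`. -/
theorem Level.step (L : Level ν N d e c M) (he : 0 < e)
    {φ : Polynomial (PowerSeries K)} (hφ : φ.Monic) (hφd : φ.natDegree = d) {w : ℕ}
    (hw : ν φ = (w : ℕ∞)) (hcw : c ≤ w) :
    Level ν N (e / e.gcd w * d) (e.gcd w) (e / e.gcd w * w)
      (M ⊔ AddSubmonoid.closure {w}) := by
  obtain ⟨b, hb⟩ := L.bound
  have hex := L.expansion hφ hφd hw hb (e / e.gcd w) le_rfl
  refine ⟨?_, ?_, ?_, b + e / e.gcd w * w, ?_⟩
  · intro h h0 hd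
    obtain ⟨i, -, m, hm, h⟩ := (hex h hd).1 h0
    refine ⟨m + i * w, AddSubmonoid.add_mem _ (AddSubmonoid.mem_sup_left hm)
      (AddSubmonoid.mem_sup_right (AddSubmonoid.mem_closure_singleton.2 ⟨i, by simp⟩)), h⟩
  · intro m hm
    obtain ⟨a, ha, z, hz, rfl⟩ := AddSubmonoid.mem_sup.1 hm
    obtain ⟨n, rfl⟩ := AddSubmonoid.mem_closure_singleton.1 hz
    exact dvd_add ((Nat.gcd_dvd_left e w).trans (L.dvd a ha))
      (Dvd.dvd.mul_left (Nat.gcd_dvd_right e w) _)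
  · intro m hm hle
    obtain ⟨j, hj, hjm, hdvd⟩ := exists_lt_div_gcd_dvd_sub he hm hle
    have hc : c ≤ m - j * w := by
      have : (j + 1) * w ≤ e / e.gcd w * w := Nat.mul_le_mul_right _ hj
      have : j * w + w ≤ m := by linarith
      omega
    obtain ⟨a, had, hav⟩ := L.surj _ hdvd hc
    refine ⟨a * φ ^ j, ?_, ?_⟩
    · have ha0 : a ≠ 0 := by
        rintro rfl
        rw [AddValuation.map_zero] at hav
        exact ENat.natCast_ne_top _ hav.symm
      rw [Polynomial.degree_mul, Polynomial.degree_pow,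
        Polynomial.degree_eq_natDegree hφ.ne_zero, hφd]
      rw [Polynomial.degree_eq_natDegree ha0] at had ⊢
      have : (j + 1) * d ≤ e / e.gcd w * d := Nat.mul_le_mul_right _ hj
      rw [nsmul_eq_mul]
      norm_cast at had ⊢
      linarith
    · rw [AddValuation.map_mul, AddValuation.map_pow, hav, hw, nsmul_eq_mul, ← Nat.cast_mul,
        ← Nat.cast_add, Nat.sub_add_cancel hjm]
  · intro s h hd hs
    exact (hex h hd).2 s hs

/-- Completeness of `K[[x]]`: a sequence of monic polynomials which converges `x`-adically has a
monic limit. -/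
theorem exists_monic_limit {d : ℕ} (ψ : ℕ → Polynomial (PowerSeries K)) (hψ : ∀ m, (ψ m).Monic)
    (hψd : ∀ m, (ψ m).natDegree = d)
    (hdvd : ∀ m n, m ≤ n → C (PowerSeries.X ^ m) ∣ ψ n - ψ m) :
    ∃ φ : Polynomial (PowerSeries K), φ.Monic ∧ φ.natDegree = d ∧
      ∀ m, C (PowerSeries.X ^ m) ∣ φ - ψ m := by
  -- The coefficient of `x ^ n` no longer changes from the index `n + 1` on, so it is read off `ψ (n
  -- + 1)`.
  let r : Polynomial (PowerSeries K) := ∑ i ∈ Finset.range d,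
    C (PowerSeries.mk fun n => PowerSeries.coeff n ((ψ (n + 1)).coeff i)) * X ^ i
  have hr : r.degree < d := by
    rw [← Polynomial.mem_degreeLT]
    refine Submodule.sum_mem _ fun i hi => Polynomial.mem_degreeLT.2 ?_
    exact (Polynomial.degree_C_mul_X_pow_le _ _).trans_lt
      (by exact_mod_cast Finset.mem_range.1 hi)
  have hm : (X ^ d + r).Monic := Polynomial.monic_X_pow_add hr
  have hd : (X ^ d + r).natDegree = d := by
    rw [Polynomial.natDegree_add_eq_left_of_degree_lt (by rwa [Polynomial.degree_X_pow]),
      Polynomial.natDegree_X_pow]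
  refine ⟨X ^ d + r, hm, hd, fun m => ?_⟩
  rw [Polynomial.C_dvd_iff_dvd_coeff]
  intro i
  rcases lt_trichotomy i d with hi | rfl | hi
  · have hc : (X ^ d + r).coeff i =
        PowerSeries.mk fun n => PowerSeries.coeff n ((ψ (n + 1)).coeff i) := by
      rw [Polynomial.coeff_add, Polynomial.coeff_X_pow, if_neg hi.ne, zero_add,
        Polynomial.finsetSum_coeff]
      simp only [Polynomial.coeff_C_mul_X_pow]
      rw [Finset.sum_ite_eq, if_pos (Finset.mem_range.2 hi)]
    rw [Polynomial.coeff_sub, hc, PowerSeries.X_pow_dvd_iff]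
    intro n hn
    rw [map_sub, PowerSeries.coeff_mk]
    have := (Polynomial.C_dvd_iff_dvd_coeff _ _).1 (hdvd (n + 1) m hn) i
    rw [Polynomial.coeff_sub, PowerSeries.X_pow_dvd_iff] at this
    have := this n (by omega)
    rw [map_sub, sub_eq_zero] at this
    rw [this, sub_self]
  · have h1 := hm.coeff_natDegree
    have h2 := (hψ m).coeff_natDegree
    rw [hd] at h1
    rw [hψd] at h2
    rw [Polynomial.coeff_sub, h1, h2, sub_self]
    exact dvd_zero _
  · rw [Polynomial.coeff_sub, Polynomial.coeff_eq_zero_of_natDegree_lt (by rwa [hd]),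
      Polynomial.coeff_eq_zero_of_natDegree_lt (by rwa [hψd]), sub_self]
    exact dvd_zero _

/-- With unbounded values there would be monic polynomials whose differences, of degree less than
`d`, are divisible by growing powers of `x` according to `bound`. Their limit would be monic of
degree `d < N` with infinite value. -/
theorem Level.bddAbove (hν : IsBranchVal ν N) (L : Level ν N d e c M) (hdN : d < N) :
    ∃ B : ℕ, ∀ ψ : Polynomial (PowerSeries K), ψ.Monic → ψ.natDegree = d → ν ψ ≤ (B : ℕ∞) := by
  obtain ⟨b, hb⟩ := L.bound
  by_contra! hcon
  choose ψ hψ hψd hψν using fun m : ℕ => hcon (m * N + b)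
  obtain ⟨φ, hφ, hφd, hlim⟩ := exists_monic_limit ψ hψ hψd (by
    intro m n hmn
    refine hb m _ ?_ (ν.map_le_sub (le_trans ?_ (hψν n).le) (hψν m).le)
    · refine (Polynomial.degree_sub_lt_left ?_ (hψ n).ne_zero ?_).trans_eq ?_
      · rw [Polynomial.degree_eq_natDegree (hψ n).ne_zero, hψd,
          Polynomial.degree_eq_natDegree (hψ m).ne_zero, hψd]
      · rw [(hψ n).leadingCoeff, (hψ m).leadingCoeff]
      · rw [Polynomial.degree_eq_natDegree (hψ n).ne_zero, hψd]
    · exact_mod_cast Nat.add_le_add_right (Nat.mul_le_mul_right N hmn) b)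
  refine hν.ne_top φ hφ.ne_zero ?_ ?_
  · rw [Polynomial.degree_eq_natDegree hφ.ne_zero, hφd]
    exact_mod_cast hdN
  · rw [ENat.eq_top_iff_forall_ge]
    intro m
    obtain ⟨q, hq⟩ := hlim m
    have h1 : φ = ψ m + C (PowerSeries.X ^ m) * q := by rw [← hq]; ring
    have hm : (m : ℕ∞) ≤ ((m * N : ℕ) : ℕ∞) := by
      exact_mod_cast Nat.le_mul_of_pos_right m hν.pos
    rw [h1]
    refine hm.trans (ν.map_le_add (le_trans ?_ (hψν m).le) ?_)
    · exact_mod_cast Nat.le_add_right _ _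
    · rw [AddValuation.map_mul, Polynomial.C_pow, AddValuation.map_pow, hν.map_C_X, nsmul_eq_mul,
        ← Nat.cast_mul]
      exact le_self_add

theorem Level.exists_max (hν : IsBranchVal ν N) (L : Level ν N d e c M) (hdN : d < N) :
    ∃ (φ : Polynomial (PowerSeries K)) (w : ℕ), φ.Monic ∧ φ.natDegree = d ∧ ν φ = (w : ℕ∞) ∧
      ∀ ψ : Polynomial (PowerSeries K), ψ.Monic → ψ.natDegree = d → ν ψ ≤ (w : ℕ∞) := by
  obtain ⟨B, hB⟩ := L.bddAbove hν hdN
  let S : Set ℕ := {n | ∃ ψ : Polynomial (PowerSeries K), ψ.Monic ∧ ψ.natDegree = d ∧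
    ν ψ = (n : ℕ∞)}
  have hS (ψ : Polynomial (PowerSeries K)) (hψ : ψ.Monic) (hd : ψ.natDegree = d) :
      ∃ n ∈ S, ν ψ = (n : ℕ∞) := by
    obtain ⟨n, hn⟩ := ENat.ne_top_iff_exists.1 ((hB ψ hψ hd).trans_lt (ENat.natCast_lt_top B)).ne
    exact ⟨n, ⟨ψ, hψ, hd, hn.symm⟩, hn.symm⟩
  have hbdd : BddAbove S := ⟨B, by
    rintro n ⟨ψ, hψ, hd, h⟩
    have := hB ψ hψ hd
    rw [h] at this
    exact_mod_cast this⟩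
  have hne : S.Nonempty := by
    obtain ⟨n, hn, -⟩ := hS (X ^ d) (Polynomial.monic_X_pow d) (Polynomial.natDegree_X_pow d)
    exact ⟨n, hn⟩
  obtain ⟨φ, hφ, hd, h⟩ := Nat.sSup_mem hne hbdd
  refine ⟨φ, sSup S, hφ, hd, h, fun ψ hψ hψd => ?_⟩
  obtain ⟨n, hn, hψn⟩ := hS ψ hψ hψd
  rw [hψn]
  exact_mod_cast le_csSup hbdd hn

/-- Otherwise some `h` of smaller degree has the same value as `φ`, and subtracting a constant
multiple of `h` from `φ` yields a monic polynomial of larger value. -/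
theorem Level.not_dvd_of_max (hν : IsBranchVal ν N) (L : Level ν N d e c M)
    {φ : Polynomial (PowerSeries K)} (hφ : φ.Monic) (hφd : φ.natDegree = d) {w : ℕ}
    (hw : ν φ = (w : ℕ∞)) (hcw : c ≤ w)
    (hmax : ∀ ψ : Polynomial (PowerSeries K), ψ.Monic → ψ.natDegree = d → ν ψ ≤ (w : ℕ∞)) :
    ¬ e ∣ w := by
  intro hdvd
  obtain ⟨h, hd, hh⟩ := L.surj w hdvd hcw
  obtain ⟨t, ht⟩ := hν.residue φ h (by rw [hw, hh]) (by rw [hh]; exact ENat.natCast_ne_top w)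
  have hdeg : (C (PowerSeries.C t) * h).degree < φ.degree := by
    rw [Polynomial.degree_eq_natDegree hφ.ne_zero, hφd]
    refine lt_of_le_of_lt ?_ hd
    rw [← Polynomial.smul_eq_C_mul]
    exact Polynomial.degree_smul_le _ _
  have h1 := hmax _ (hφ.sub_of_left hdeg) (by
    rw [Polynomial.natDegree_eq_of_degree_eq (Polynomial.degree_sub_eq_left_of_degree_lt hdeg),
        hφd])
  rw [hh] at ht
  exact absurd h1 (not_le.2 ht)

end Levels

/-! ### The successive gcds -/

section Gcd

theorem gcdUpTo_zero (w : ℕ → ℕ) : gcdUpTo w 0 = w 0 := by simp [gcdUpTo]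

theorem gcdUpTo_succ (w : ℕ → ℕ) (k : ℕ) :
    gcdUpTo w (k + 1) = (gcdUpTo w k).gcd (w (k + 1)) := by
  rw [gcdUpTo, Finset.range_add_one, Finset.gcd_insert, Nat.gcd_comm]
  rfl

theorem gcdUpTo_dvd {w : ℕ → ℕ} {i k : ℕ} (h : i ≤ k) : gcdUpTo w k ∣ w i :=
  Finset.gcd_dvd (Finset.mem_range.2 (by omega))

theorem gcdUpTo_succ_dvd (w : ℕ → ℕ) (k : ℕ) : gcdUpTo w (k + 1) ∣ gcdUpTo w k := by
  rw [gcdUpTo_succ]; exact Nat.gcd_dvd_left _ _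

theorem gcdUpTo_pos {w : ℕ → ℕ} (h : 0 < w 0) (k : ℕ) : 0 < gcdUpTo w k :=
  Nat.pos_of_dvd_of_pos (gcdUpTo_dvd (Nat.zero_le k)) h

theorem gcdUpTo_congr {w w' : ℕ → ℕ} {k : ℕ} (h : ∀ i ≤ k, w i = w' i) :
    gcdUpTo w k = gcdUpTo w' k :=
  Finset.gcd_congr rfl fun i hi => h i (by have := Finset.mem_range.1 hi; omega)

theorem gcdUpTo_mul {w w' : ℕ → ℕ} {k a b : ℕ} (h : ∀ i ≤ k, w i * a = w' i * b) :
    gcdUpTo w k * a = gcdUpTo w' k * b := by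
  induction k with
  | zero => rw [gcdUpTo_zero, gcdUpTo_zero]; exact h 0 le_rfl
  | succ k ih =>
    rw [gcdUpTo_succ, gcdUpTo_succ, ← Nat.gcd_mul_right, ← Nat.gcd_mul_right,
      ih fun i hi => h i (by omega), h (k + 1) le_rfl]

end Gcd

/-! ### Key polynomials and minimal generators -/

section KeySequences

variable {K : Type*} [Field K] {ν : AddValuation (Polynomial (PowerSeries K)) ℕ∞} {N : ℕ}

/-- A sequence of key polynomials `φ 0, …, φ (k - 1)` of a valuation `ν`, with values
`w 1, …, w k`. -/
structure KeySeq (ν : AddValuation (Polynomial (PowerSeries K)) ℕ∞) (N k : ℕ) (w : ℕ → ℕ)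
    (φ : ℕ → Polynomial (PowerSeries K)) : Prop where
  zero : w 0 = N
  monic : ∀ i < k, (φ i).Monic
  natDegree : ∀ i < k, (φ i).natDegree * gcdUpTo w i = N
  map : ∀ i < k, ν (φ i) = (w (i + 1) : ℕ∞)
  not_dvd : ∀ i < k, ¬ gcdUpTo w i ∣ w (i + 1)
  growth : ∀ i, i + 1 < k → gcdUpTo w i * w (i + 1) < gcdUpTo w (i + 1) * w (i + 2)

/-- The bound from which on all multiples of `gcdUpTo w k` are values. -/
def conductorBound (w : ℕ → ℕ) : ℕ → ℕ
  | 0 => 0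
  | k + 1 => gcdUpTo w k / gcdUpTo w (k + 1) * w (k + 1)

variable {k : ℕ} {w : ℕ → ℕ} {φ : ℕ → Polynomial (PowerSeries K)}

theorem KeySeq.mono (h : KeySeq ν N k w φ) {j : ℕ} (hj : j ≤ k) : KeySeq ν N j w φ where
  zero := h.zero
  monic i hi := h.monic i (by omega)
  natDegree i hi := h.natDegree i (by omega)
  map i hi := h.map i (by omega)
  not_dvd i hi := h.not_dvd i (by omega)
  growth i hi := h.growth i (by omega)

theorem KeySeq.gcdUpTo_pos (h : KeySeq ν N k w φ) (hN : 0 < N) (i : ℕ) : 0 < gcdUpTo w i :=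
  PlaneCurve.gcdUpTo_pos (by rw [h.zero]; exact hN) i

theorem KeySeq.conductorBound_le (h : KeySeq ν N (k + 1) w φ) (hN : 0 < N) :
    conductorBound w k ≤ w (k + 1) := by
  cases k with
  | zero => exact Nat.zero_le _
  | succ k =>
    have h1 := h.growth k (by omega)
    have h2 := h.gcdUpTo_pos hN (k + 1)
    have h3 := Nat.div_mul_cancel (gcdUpTo_succ_dvd w k)
    simp only [conductorBound]
    by_contra! hlt
    have := Nat.mul_lt_mul_of_pos_left hlt h2
    nlinarith

theorem closure_image_Iic_succ (w : ℕ → ℕ) (k : ℕ) :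
    AddSubmonoid.closure (w '' Set.Iic (k + 1)) =
      AddSubmonoid.closure (w '' Set.Iic k) ⊔ AddSubmonoid.closure {w (k + 1)} := by
  rw [← AddSubmonoid.closure_union]
  congr 1
  ext x
  simp only [Set.mem_image, Set.mem_Iic, Set.mem_union, Set.mem_singleton_iff]
  constructor
  · rintro ⟨i, hi, rfl⟩
    rcases Nat.lt_or_ge k i with h | h
    · right; congr 1; omega
    · exact Or.inl ⟨i, h, rfl⟩
  · rintro (⟨i, hi, rfl⟩ | rfl)
    · exact ⟨i, by omega, rfl⟩
    · exact ⟨k + 1, le_rfl, rfl⟩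

theorem KeySeq.level (hν : IsBranchVal ν N) (h : KeySeq ν N k w φ) {d : ℕ}
    (hd : d * gcdUpTo w k = N) :
    Level ν N d (gcdUpTo w k) (conductorBound w k) (AddSubmonoid.closure (w '' Set.Iic k)) := by
  induction k generalizing d with
  | zero =>
    rw [gcdUpTo_zero, h.zero] at hd ⊢
    have hd1 : d = 1 := Nat.eq_of_mul_eq_mul_right hν.pos (by rw [hd, one_mul])
    have hI : w '' Set.Iic 0 = {N} := by
      ext x; simp [h.zero, eq_comm]
    rw [hd1, hI]
    exact level_zero hν
  | succ k ih =>
    have hpos := h.gcdUpTo_pos hν.pos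
    have hk := h.natDegree k (by omega)
    have L := (ih (h.mono (by omega)) hk).step (hpos k) (h.monic k (by omega)) rfl
      (h.map k (by omega)) (h.conductorBound_le hν.pos)
    rw [← gcdUpTo_succ, ← closure_image_Iic_succ] at L
    have hd' : gcdUpTo w k / gcdUpTo w (k + 1) * (φ k).natDegree = d := by
      refine Nat.eq_of_mul_eq_mul_right (hpos (k + 1)) ?_
      rw [hd, mul_right_comm, Nat.div_mul_cancel (gcdUpTo_succ_dvd w k), mul_comm, hk]
    rw [hd'] at L
    exact L

/-- The new key polynomial is a monic polynomial of degree `N / gcdUpTo w k` with maximal value.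
That value is not a multiple of `gcdUpTo w k`, so the gcd drops. -/
theorem KeySeq.exists_extend (hν : IsBranchVal ν N) (h : KeySeq ν N k w φ)
    (he : gcdUpTo w k ≠ 1) : ∃ w' φ', KeySeq ν N (k + 1) w' φ' ∧
      gcdUpTo w' (k + 1) < gcdUpTo w k := by
  have hpos := h.gcdUpTo_pos hν.pos
  have hdvd : gcdUpTo w k ∣ N := h.zero ▸ gcdUpTo_dvd (Nat.zero_le k)
  obtain ⟨d, hd⟩ := hdvd
  rw [mul_comm] at hd
  have hd0 : 0 < d := Nat.pos_of_ne_zero fun h0 => by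
    rw [h0, zero_mul] at hd; exact absurd hd hν.pos.ne'
  have hdN : d < N := by
    have := hpos k
    have : 2 ≤ gcdUpTo w k := by omega
    rw [hd]; nlinarith
  have L := h.level hν hd.symm
  obtain ⟨ψ, m, hψ, hψd, hψm, hmax⟩ := L.exists_max hν hdN
  -- A power of the previous key polynomial has the degree in question and value `conductorBound w
  -- k`, so maximality applies to it.
  have hcm : conductorBound w k ≤ m := by
    cases k with
    | zero => exact Nat.zero_le _
    | succ k =>
      have hk := h.natDegree k (by omega)
      have := hmax (φ k ^ (gcdUpTo w k / gcdUpTo w (k + 1))) ((h.monic k (by omega)).pow _) (by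
        rw [(h.monic k (by omega)).natDegree_pow]
        refine Nat.eq_of_mul_eq_mul_right (hpos (k + 1)) ?_
        rw [← hd, mul_right_comm, Nat.div_mul_cancel (gcdUpTo_succ_dvd w k), mul_comm, hk])
      rw [AddValuation.map_pow, h.map k (by omega), nsmul_eq_mul] at this
      exact_mod_cast this
  have hnd := L.not_dvd_of_max hν hψ hψd hψm hcm hmax
  have hw (i : ℕ) (hi : i ≤ k) : Function.update w (k + 1) m i = w i :=
    Function.update_of_ne (by omega) _ _
  have hφ (i : ℕ) (hi : i < k) : Function.update φ k ψ i = φ i :=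
    Function.update_of_ne (by omega) _ _
  have hg (i : ℕ) (hi : i ≤ k) : gcdUpTo (Function.update w (k + 1) m) i = gcdUpTo w i :=
    gcdUpTo_congr fun j hj => hw j (by omega)
  refine ⟨Function.update w (k + 1) m, Function.update φ k ψ, ⟨?_, ?_, ?_, ?_, ?_, ?_⟩, ?_⟩
  · rw [hw 0 (Nat.zero_le _), h.zero]
  · intro i hi
    rcases Nat.lt_succ_iff_lt_or_eq.1 hi with hi | rfl
    · rw [hφ i hi]; exact h.monic i hi
    · simpa using hψ
  · intro i hi
    rw [hg i (by omega)]
    rcases Nat.lt_succ_iff_lt_or_eq.1 hi with hi | rfl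
    · rw [hφ i hi]; exact h.natDegree i hi
    · simpa [hψd] using hd.symm
  · intro i hi
    rcases Nat.lt_succ_iff_lt_or_eq.1 hi with hi | rfl
    · rw [hφ i hi, hw (i + 1) (by omega)]; exact h.map i hi
    · simpa using hψm
  · intro i hi
    rw [hg i (by omega)]
    rcases Nat.lt_succ_iff_lt_or_eq.1 hi with hi | rfl
    · rw [hw (i + 1) (by omega)]; exact h.not_dvd i hi
    · simpa using hnd
  · intro i hi
    rw [hg i (by omega), hg (i + 1) (by omega), hw (i + 1) (by omega)]
    rcases Nat.lt_succ_iff_lt_or_eq.1 hi with hi | rfl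
    · rw [hw (i + 2) (by omega)]; exact h.growth i hi
    · rw [Function.update_self]
      refine lt_of_le_of_ne ?_ ?_
      · simp only [conductorBound] at hcm
        have h3 := Nat.div_mul_cancel (gcdUpTo_succ_dvd w i)
        calc gcdUpTo w i * w (i + 1)
            = gcdUpTo w (i + 1) * (gcdUpTo w i / gcdUpTo w (i + 1) * w (i + 1)) := by
              rw [← h3]; rw [Nat.mul_div_cancel _ (hpos _)]; ring
          _ ≤ _ := Nat.mul_le_mul_left _ hcm
      -- Equality would make `m` a multiple of `w (i + 1)`, hence of the current gcd.
      · intro heq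
        apply hnd
        have h3 := Nat.div_mul_cancel (gcdUpTo_succ_dvd w i)
        have : m = gcdUpTo w i / gcdUpTo w (i + 1) * w (i + 1) := by
          refine Nat.eq_of_mul_eq_mul_left (hpos (i + 1)) ?_
          rw [← heq, ← mul_assoc, mul_comm (gcdUpTo w (i + 1)), h3]
        rw [this]
        exact Dvd.dvd.mul_left (gcdUpTo_dvd le_rfl) _
  · rw [gcdUpTo_succ, Function.update_self, hg k le_rfl]
    refine lt_of_le_of_ne (Nat.gcd_le_left _ (hpos k)) fun heq => hnd ?_
    rw [← heq]; exact Nat.gcd_dvd_right _ _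

theorem exists_keySeq (hν : IsBranchVal ν N) : ∃ k w φ, KeySeq ν N k w φ ∧ gcdUpTo w k = 1 := by
  have key (e : ℕ) : ∀ k w φ, KeySeq ν N k w φ → gcdUpTo w k = e →
      ∃ k w φ, KeySeq ν N k w φ ∧ gcdUpTo w k = 1 := by
    induction e using Nat.strong_induction_on with
    | _ e ih =>
      intro k w φ h he
      rcases eq_or_ne e 1 with rfl | he1
      · exact ⟨k, w, φ, h, he⟩
      · obtain ⟨w', φ', h', hlt⟩ := h.exists_extend hν (he ▸ he1)
        exact ih _ (he ▸ hlt) _ _ _ h' rfl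
  refine key _ 0 (fun _ => N) (fun _ => 0) ⟨rfl, ?_, ?_, ?_, ?_, ?_⟩ rfl <;>
  · intro i hi; omega

/-- The set of finite values of a valuation. -/
def valueSet (ν : AddValuation (Polynomial (PowerSeries K)) ℕ∞) : Set ℕ :=
  {n | ∃ h, ν h = (n : ℕ∞)}

theorem KeySeq.closure_subset (hν : IsBranchVal ν N) (h : KeySeq ν N k w φ) :
    (AddSubmonoid.closure (w '' Set.Iic k) : Set ℕ) ⊆ valueSet ν := by
  let S : AddSubmonoid ℕ :=
    { carrier := valueSet ν
      zero_mem' := ⟨1, by simp⟩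
      add_mem' := by
        rintro a b ⟨f, hf⟩ ⟨g, hg⟩
        exact ⟨f * g, by rw [AddValuation.map_mul, hf, hg]; simp⟩ }
  change AddSubmonoid.closure (w '' Set.Iic k) ≤ S
  rw [AddSubmonoid.closure_le]
  rintro _ ⟨i, hi, rfl⟩
  cases i with
  | zero => exact ⟨C PowerSeries.X, by rw [hν.map_C_X, h.zero]⟩
  | succ i => exact ⟨φ i, h.map i hi⟩

/-- When the gcd is 1 the level covers all degrees below `N`, and every finite value is attained
there by a remainder. -/
theorem KeySeq.valueSet_eq (hν : IsBranchVal ν N) (h : KeySeq ν N k w φ)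
    (he : gcdUpTo w k = 1) :
    valueSet ν = (AddSubmonoid.closure (w '' Set.Iic k) : Set ℕ) := by
  refine Set.Subset.antisymm ?_ (h.closure_subset hν)
  rintro n ⟨f, hf⟩
  obtain ⟨r, hr0, hr, hrf⟩ := hν.reduce f (by rw [hf]; exact ENat.natCast_ne_top n)
  obtain ⟨m, hm, hmr⟩ := (h.level hν (d := N) (by rw [he, mul_one])).mem r hr0 hr
  rw [← hrf, hmr] at hf
  rw [← Nat.cast_injective (R := ℕ∞) hf]
  exact hm

/-- A value smaller than `ν (φ i)` does not change on division with remainder by `φ i`, so it is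
already a value of a polynomial of smaller degree. -/
theorem KeySeq.isLeast (hν : IsBranchVal ν N) (h : KeySeq ν N k w φ) {i : ℕ} (hi : i < k) :
    IsLeast (valueSet ν \ (AddSubmonoid.closure (w '' Set.Iio (i + 1)) : Set ℕ)) (w (i + 1)) := by
  have hI : Set.Iio (i + 1) = Set.Iic i := by ext; simp
  have L := (h.mono hi.le).level hν (h.natDegree i hi)
  rw [hI]
  refine ⟨⟨⟨φ i, h.map i hi⟩, fun hm => h.not_dvd i hi (L.dvd _ hm)⟩, ?_⟩
  rintro n ⟨⟨f, hf⟩, hn⟩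
  by_contra! hlt
  apply hn
  have hlt' : ν f < ν (φ i * (f /ₘ φ i)) := by
    rw [AddValuation.map_mul, h.map i hi, hf]
    exact lt_of_lt_of_le (by exact_mod_cast hlt) le_self_add
  have hr : ν (f %ₘ φ i) = ν f := by
    rw [Polynomial.modByMonic_eq_sub_mul_div,
      AddValuation.map_sub_eq_of_lt_left ν hlt']
  have hr0 : f %ₘ φ i ≠ 0 := by
    intro h0
    rw [h0, AddValuation.map_zero, hf] at hr
    exact ENat.natCast_ne_top n hr.symm
  obtain ⟨m, hm, hmr⟩ := L.mem _ hr0 (by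
    rw [← Polynomial.degree_eq_natDegree (h.monic i hi).ne_zero]
    exact Polynomial.degree_modByMonic_lt _ (h.monic i hi))
  rw [hr, hf] at hmr
  rw [Nat.cast_injective (R := ℕ∞) hmr]
  exact hm

/-- The values of a sequence of key polynomials are the first minimal generators. -/
theorem KeySeq.eq_generators (hν : IsBranchVal ν N) (h : KeySeq ν N k w φ) {g : ℕ} {v : ℕ → ℕ}
    (hv : IsMinimalGenerators (valueSet ν) g v) (hv0 : v 0 = N) :
    k ≤ g ∧ ∀ i ≤ k, v i = w i := by
  have key (j : ℕ) (hj : j ≤ k) : j ≤ g ∧ ∀ i ≤ j, v i = w i := by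
    induction j with
    | zero =>
      refine ⟨Nat.zero_le _, fun i hi => ?_⟩
      obtain rfl : i = 0 := by omega
      rw [hv0, h.zero]
    | succ j ih =>
      obtain ⟨hjg, hvw⟩ := ih (by omega)
      have hl := h.isLeast hν (i := j) (by omega)
      have himg : v '' Set.Iio (j + 1) = w '' Set.Iio (j + 1) :=
        Set.image_congr fun i hi => hvw i (Nat.lt_succ_iff.1 hi)
      have hjg' : j + 1 ≤ g := by
        by_contra! hlt
        obtain rfl : j = g := by omega
        apply hl.1.2
        have hI : Set.Iio (j + 1) = Set.Iic j := by ext; simp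
        rw [← himg, hI, ← hv.eq_closure]
        exact hl.1.1
      refine ⟨hjg', fun i hi => ?_⟩
      rcases Nat.le_succ_iff.1 hi with hi | rfl
      · exact hvw i hi
      · have := hv.isLeast (j + 1) (by omega) hjg'
        rw [himg] at this
        exact this.unique hl
  exact key k le_rfl

theorem KeySeq.isMinimalGenerators (hν : IsBranchVal ν N) (h : KeySeq ν N k w φ)
    (he : gcdUpTo w k = 1) (hw : ∀ i ≤ k, N ≤ w i) : IsMinimalGenerators (valueSet ν) k w where
  isLeast_zero := by
    rw [h.zero]
    refine ⟨⟨⟨C PowerSeries.X, hν.map_C_X⟩, hν.pos.ne'⟩, ?_⟩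
    rintro n ⟨hn, hn0⟩
    rw [h.valueSet_eq hν he] at hn
    have : ∀ m ∈ AddSubmonoid.closure (w '' Set.Iic k), m = 0 ∨ N ≤ m := by
      intro m hm
      induction hm using AddSubmonoid.closure_induction with
      | mem x hx =>
        obtain ⟨i, hi, rfl⟩ := hx
        exact Or.inr (hw i hi)
      | zero => exact Or.inl rfl
      | add x y _ _ hx hy => omega
    exact (this n hn).resolve_left hn0
  isLeast i h1 hi := by
    obtain ⟨j, rfl⟩ : ∃ j, i = j + 1 := ⟨i - 1, by omega⟩
    exact h.isLeast hν (by omega)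
  eq_closure := h.valueSet_eq hν he

/-- Proper monic factors have smaller degree, hence values divisible by `gcdUpTo w i`; the value of
`φ i` is not divisible by it. -/
theorem KeySeq.irreducible (hν : IsBranchVal ν N) (h : KeySeq ν N k w φ) {i : ℕ} (hi : i < k) :
    Irreducible (φ i) := by
  have L := (h.mono hi.le).level hν (h.natDegree i hi)
  have hne : φ i ≠ 1 := by
    intro h1
    have h2 := h.map i hi
    rw [h1, AddValuation.map_one] at h2
    apply h.not_dvd i hi
    have : w (i + 1) = 0 := by exact_mod_cast h2.symm
    rw [this]; exact dvd_zero _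
  rw [(h.monic i hi).irreducible_iff_natDegree']
  refine ⟨hne, fun f g hf hg hfg hmem => ?_⟩
  rw [Finset.mem_Ioc] at hmem
  have hdeg : f.natDegree + g.natDegree = (φ i).natDegree := by
    rw [← hfg, hf.natDegree_mul hg]
  have hlt {f : Polynomial (PowerSeries K)} (hf : f.Monic) (h : f.natDegree < (φ i).natDegree) :
      f.degree < (φ i).natDegree := by
    rw [Polynomial.degree_eq_natDegree hf.ne_zero]; exact_mod_cast h
  obtain ⟨a, ha, hfa⟩ := L.mem f hf.ne_zero (hlt hf (by omega))
  obtain ⟨b, hb, hgb⟩ := L.mem g hg.ne_zero (hlt hg (by omega))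
  apply h.not_dvd i hi
  have h1 := h.map i hi
  rw [← hfg, AddValuation.map_mul, hfa, hgb, ← Nat.cast_add] at h1
  rw [← Nat.cast_injective (R := ℕ∞) h1]
  exact dvd_add (L.dvd a ha) (L.dvd b hb)

/-- A sequence of key polynomials of `ν` is one of `ν'` if the values are proportional. -/
theorem KeySeq.transfer (hN : 0 < N) (h : KeySeq ν N k w φ)
    {ν' : AddValuation (Polynomial (PowerSeries K)) ℕ∞} {N' : ℕ} (hN' : 0 < N')
    (hval : ∀ i < k, N • ν' (φ i) = N' • ν (φ i)) :
    ∃ w', KeySeq ν' N' k w' φ ∧ ∀ i ≤ k, w' i * N = w i * N' := by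
  have hfin (i : ℕ) (hi : i < k) : ∃ m : ℕ, ν' (φ i) = (m : ℕ∞) := by
    have h1 := hval i hi
    refine (ENat.ne_top_iff_exists.1 fun h2 => ?_).imp fun m hm => hm.symm
    rw [h2, h.map i hi, nsmul_eq_mul, nsmul_eq_mul, ENat.mul_top (by exact_mod_cast hN.ne'),
      ← Nat.cast_mul] at h1
    exact ENat.natCast_ne_top _ h1.symm
  let w' : ℕ → ℕ := fun i => if i = 0 then N' else (ν' (φ (i - 1))).toNat
  have hw' (i : ℕ) (hi : i < k) : ν' (φ i) = (w' (i + 1) : ℕ∞) := by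
    obtain ⟨m, hm⟩ := hfin i hi
    simp [w', hm]
  have hprop : ∀ i ≤ k, w' i * N = w i * N' := by
    intro i hi
    cases i with
    | zero => simp [w', h.zero, mul_comm]
    | succ i =>
      have h1 := hval i hi
      rw [hw' i hi, h.map i hi, nsmul_eq_mul, nsmul_eq_mul] at h1
      rw [mul_comm, mul_comm (w _)]
      exact_mod_cast h1
  have hg (i : ℕ) (hi : i ≤ k) : gcdUpTo w' i * N = gcdUpTo w i * N' :=
    gcdUpTo_mul fun j hj => hprop j (by omega)
  refine ⟨w', ⟨by simp [w'], h.monic, ?_, hw', ?_, ?_⟩, hprop⟩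
  · intro i hi
    refine Nat.eq_of_mul_eq_mul_right hN ?_
    rw [mul_assoc, hg i hi.le, ← mul_assoc, h.natDegree i hi, mul_comm]
  · intro i hi hdvd
    apply h.not_dvd i hi
    have := Nat.mul_dvd_mul_right hdvd N
    rw [hg i hi.le, hprop (i + 1) hi] at this
    exact Nat.dvd_of_mul_dvd_mul_right hN' this
  · intro i hi
    have h1 := h.growth i hi
    have h2 : gcdUpTo w' i * w' (i + 1) * (N * N) < gcdUpTo w' (i + 1) * w' (i + 2) * (N * N) := by
      rw [mul_mul_mul_comm, mul_mul_mul_comm (gcdUpTo w' (i + 1)), hg i (by omega),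
        hg (i + 1) (by omega), hprop (i + 1) (by omega), hprop (i + 2) (by omega),
        mul_mul_mul_comm, mul_mul_mul_comm (gcdUpTo w (i + 1))]
      exact Nat.mul_lt_mul_of_pos_right h1 (Nat.mul_pos hN' hN')
    exact Nat.lt_of_mul_lt_mul_right h2

end KeySequences

/-! ### Distinguished polynomials in polynomial and power series rings -/

section Distinguished

/-- Modulo the maximal ideal, `P` is a power of the variable and so is its monic factor `a`. In
positive degree the constant term of `a` lies in the maximal ideal, so `a` is not a unit. -/
theorem natDegree_eq_zero_of_isUnit_coe {A : Type*} [CommRing A] [IsLocalRing A]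
    {P a b : Polynomial A} (hP : P.IsDistinguishedAt (IsLocalRing.maximalIdeal A)) (ha : a.Monic)
    (hab : a * b = P) (hu : IsUnit (a : PowerSeries A)) : a.natDegree = 0 := by
  have h1 := hP.map_eq_X_pow
  have h2 : a.map (Ideal.Quotient.mk (IsLocalRing.maximalIdeal A)) ∣
      X ^ P.natDegree := ⟨b.map _, by rw [← Polynomial.map_mul, hab, h1]⟩
  have := (Ideal.Quotient.isDomain_iff_prime (IsLocalRing.maximalIdeal A)).2
    (IsLocalRing.maximalIdeal.isMaximal A).isPrime
  obtain ⟨i, -, hi⟩ := (dvd_prime_pow Polynomial.prime_X _).1 h2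
  have h3 := Polynomial.eq_of_monic_of_associated (ha.map _) (Polynomial.monic_X_pow i) hi
  have hid : i = a.natDegree := by
    rw [← ha.natDegree_map (Ideal.Quotient.mk (IsLocalRing.maximalIdeal A)), h3,
      Polynomial.natDegree_X_pow]
  by_contra hne
  have h4 : a.coeff 0 ∈ IsLocalRing.maximalIdeal A := by
    rw [← Ideal.Quotient.eq_zero_iff_mem, ← Polynomial.coeff_map, h3, Polynomial.coeff_X_pow,
      if_neg (by omega)]
  rw [PowerSeries.isUnit_iff_constantCoeff, ← PowerSeries.coeff_zero_eq_constantCoeff_apply,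
    Polynomial.coeff_coe] at hu
  exact h4 hu

theorem irreducible_of_irreducible_coe {A : Type*} [CommRing A] [IsDomain A] [IsLocalRing A]
    {P : Polynomial A} (hP : P.IsDistinguishedAt (IsLocalRing.maximalIdeal A))
    (h : Irreducible (P : PowerSeries A)) : Irreducible P := by
  rw [hP.monic.irreducible_iff_natDegree']
  refine ⟨fun h1 => h.not_isUnit (by rw [h1]; simp), fun a b ha hb hab hmem => ?_⟩
  rw [Finset.mem_Ioc] at hmem
  have hdeg : a.natDegree + b.natDegree = P.natDegree := by rw [← hab, ha.natDegree_mul hb]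
  rcases h.isUnit_or_isUnit (a := (a : PowerSeries A)) (b := (b : PowerSeries A))
    (by rw [← hab]; simp) with hu | hu
  · have := natDegree_eq_zero_of_isUnit_coe hP ha hab hu
    omega
  · have := natDegree_eq_zero_of_isUnit_coe hP hb (by rw [mul_comm]; exact hab) hu
    omega

/-- Weierstrass division identifies the quotients of the polynomial and power series rings by `P`,
so primality carries over. -/
theorem irreducible_coe {A : Type*} [CommRing A] [IsDomain A] [IsLocalRing A]
    [IsAdicComplete (IsLocalRing.maximalIdeal A) A]
    {P : Polynomial A} (hP : P.IsDistinguishedAt (IsLocalRing.maximalIdeal A))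
    (h : Prime P) : Irreducible (P : PowerSeries A) := by
  have h1 : (Ideal.span {P}).IsPrime := (Ideal.span_singleton_prime h.ne_zero).2 h
  have h2 := (Ideal.Quotient.isDomain_iff_prime _).2 h1
  have h3 : IsDomain (PowerSeries A ⧸ Ideal.span {(P : PowerSeries A)}) :=
    hP.algEquivQuotient.symm.toRingEquiv.toMulEquiv.isDomain _
  have h0 : (P : PowerSeries A) ≠ 0 := by
    rw [Ne, Polynomial.coe_eq_zero_iff]; exact h.ne_zero
  exact ((Ideal.span_singleton_prime h0).1 ((Ideal.Quotient.isDomain_iff_prime _).1 h3)).irreducible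

theorem exists_dvd_sub_coe {A : Type*} [CommRing A] [IsLocalRing A]
    [IsAdicComplete (IsLocalRing.maximalIdeal A) A]
    {P : Polynomial A} (hP : P.IsDistinguishedAt (IsLocalRing.maximalIdeal A))
    (h : PowerSeries A) : ∃ r : Polynomial A, (P : PowerSeries A) ∣ h - r := by
  obtain ⟨y, hy⟩ := hP.algEquivQuotient.surjective (Ideal.Quotient.mk _ h)
  obtain ⟨r, rfl⟩ := Ideal.Quotient.mk_surjective y
  refine ⟨r, ?_⟩
  rw [← Ideal.mem_span_singleton, ← Ideal.Quotient.mk_eq_mk_iff_sub_mem, ← hy,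
    Polynomial.IsDistinguishedAt.algEquivQuotient_apply]
  rfl

/-- Every series is congruent to a polynomial modulo `P`, so the coefficient of `r` can be taken
polynomial; that of `P` then is one too. -/
theorem coe_mem_span_pair_iff {A : Type*} [CommRing A] [IsLocalRing A]
    [IsAdicComplete (IsLocalRing.maximalIdeal A) A]
    {P : Polynomial A} (hP : P.IsDistinguishedAt (IsLocalRing.maximalIdeal A))
    (r h : Polynomial A) :
    (h : PowerSeries A) ∈ (Ideal.span {(P : PowerSeries A), (r : PowerSeries A)}) ↔
      h ∈ (Ideal.span {P, r}) := by
  rw [Ideal.mem_span_pair, Ideal.mem_span_pair]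
  constructor
  · rintro ⟨a, b, hab⟩
    obtain ⟨b₀, b', hb⟩ := exists_dvd_sub_coe hP b
    have hdvd : P ∣ h - r * b₀ := by
      apply dvd_of_coe_dvd_coe hP
      refine ⟨a + r * b', ?_⟩
      rw [Polynomial.coe_sub, Polynomial.coe_mul, ← hab]
      linear_combination (r : PowerSeries A) * hb
    obtain ⟨q, hq⟩ := hdvd
    exact ⟨q, b₀, by linear_combination -hq⟩
  · rintro ⟨a, b, hab⟩
    exact ⟨a, b, by rw [← hab]; simp⟩

variable {K : Type*} [Field K]

/-- A monic irreducible polynomial which vanishes at the origin is distinguished. -/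
theorem isDistinguishedAt_of_irreducible {φ : Polynomial (PowerSeries K)} (hφ : φ.Monic)
    (hirr : Irreducible φ) (h0 : PowerSeries.constantCoeff (φ.coeff 0) = 0) :
    φ.IsDistinguishedAt (IsLocalRing.maximalIdeal (PowerSeries K)) := by
  classical
  have hex : ∃ n, PowerSeries.constantCoeff (φ.coeff n) ≠ 0 :=
    ⟨φ.natDegree, by rw [hφ.coeff_natDegree]; simp⟩
  have hn : Nat.find hex ≠ 0 := fun h => Nat.find_spec hex (by rw [h]; exact h0)
  obtain ⟨W, hW, hdvd, hd⟩ := exists_distinguished_dvd (Nat.find_spec hex)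
    (fun i hi => not_not.1 (Nat.find_min hex hi))
  rcases hirr.dvd_iff.1 hdvd with h | h
  · exact absurd (Polynomial.natDegree_eq_zero_of_isUnit h) (by omega)
  · rwa [Polynomial.eq_of_monic_of_associated hφ hW.monic h]

theorem toENat_rank_quotient_coe {P : Polynomial (PowerSeries K)}
    (hP : P.IsDistinguishedAt (IsLocalRing.maximalIdeal (PowerSeries K)))
    (r : Polynomial (PowerSeries K)) :
    Module.rank K (PowerSeries (PowerSeries K) ⧸
        (Ideal.span {(P : PowerSeries (PowerSeries K)), (r : PowerSeries (PowerSeries K))})) =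
      Module.rank K (Polynomial (PowerSeries K) ⧸ (Ideal.span {P, r})) := by
  let I := Ideal.span {(P : PowerSeries (PowerSeries K)), (r : PowerSeries (PowerSeries K))}
  let T : Polynomial (PowerSeries K) →ₗ[K] (PowerSeries (PowerSeries K) ⧸ I) :=
    { toFun := fun h => Ideal.Quotient.mk I h
      map_add' := fun a b => by simp
      map_smul' := fun c a => by
        have : ((c • a : Polynomial (PowerSeries K)) : PowerSeries (PowerSeries K)) =
            c • (a : PowerSeries (PowerSeries K)) := by
          ext i j; simp
        rw [this]; rfl }
  have hT : Function.Surjective T := by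
    intro y
    obtain ⟨h, rfl⟩ := Ideal.Quotient.mk_surjective y
    obtain ⟨s, hs⟩ := exists_dvd_sub_coe hP h
    refine ⟨s, ?_⟩
    change Ideal.Quotient.mk I s = _
    rw [eq_comm, Ideal.Quotient.mk_eq_mk_iff_sub_mem]
    exact Ideal.mem_of_dvd I hs (Ideal.subset_span (by simp))
  have hker : LinearMap.ker T = (Ideal.span {P, r}).restrictScalars K := by
    ext h
    rw [LinearMap.mem_ker, Submodule.restrictScalars_mem, ← coe_mem_span_pair_iff hP]
    exact Ideal.Quotient.eq_zero_iff_mem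
  exact (((Submodule.quotEquivOfEq _ _ hker.symm).trans
    (T.quotKerEquivOfSurjective hT)).rank_eq).symm

end Distinguished

/-! ### Intersection numbers through a distinguished equation -/

section Equation

variable {K : Type*} [Field K]

/-- The polynomial `P` is a distinguished equation of the branch `f` in the coordinates `Φ`. -/
structure IsEquation (Φ : Series K ≃ₐ[K] PowerSeries (PowerSeries K)) (f : Series K)
    (P : Polynomial (PowerSeries K)) : Prop where
  isDistinguishedAt : P.IsDistinguishedAt (IsLocalRing.maximalIdeal (PowerSeries K))
  irreducible : Irreducible P
  associated : Associated (P : PowerSeries (PowerSeries K)) (Φ f)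

variable {Φ : Series K ≃ₐ[K] PowerSeries (PowerSeries K)} {f : Series K}
  {P : Polynomial (PowerSeries K)}

theorem IsEquation.dvd_iff (h : IsEquation Φ f P) {s : Series K} {r : Polynomial (PowerSeries K)}
    (hr : (P : PowerSeries (PowerSeries K)) ∣ Φ s - r) : f ∣ s ↔ P ∣ r := by
  rw [← map_dvd_iff Φ, ← h.associated.dvd_iff_dvd_left]
  constructor
  · intro hd
    exact dvd_of_coe_dvd_coe h.isDistinguishedAt (by simpa using dvd_sub hd hr)
  · rintro ⟨q, rfl⟩
    have h2 : (P : PowerSeries (PowerSeries K)) ∣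
        ((P * q : Polynomial (PowerSeries K)) : PowerSeries (PowerSeries K)) := by simp
    simpa using dvd_add hr h2

/-- The link between geometry and valuation: modulo `P` the series `s` may be replaced by a
polynomial `r`, and the quotient by `(f, s)` becomes that of `K[[x]][y]` by `(P, r)`. -/
theorem IsEquation.intersectionNumber_eq (h : IsEquation Φ f P) {s : Series K}
    {r : Polynomial (PowerSeries K)} (hr : (P : PowerSeries (PowerSeries K)) ∣ Φ s - r)
    (hs : ¬ f ∣ s) :
    intersectionNumber f s = branchVal P h.isDistinguishedAt.monic h.irreducible r := by
  rw [h.dvd_iff hr] at hs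
  rw [← toENat_rank_quotient_eq_branchVal _ _ hs, ← toENat_rank_quotient_coe h.isDistinguishedAt]
  have hI : (Ideal.span {(P : PowerSeries (PowerSeries K)), (r : PowerSeries (PowerSeries K))}) =
      (Ideal.span {f, s}).map (Φ : Series K →+* PowerSeries (PowerSeries K)) := by
    rw [Ideal.map_span, Set.image_pair]
    have h1 := h.associated.dvd
    have h2 := h.associated.symm.dvd
    apply le_antisymm
    · have hP := Ideal.mem_of_dvd (Ideal.span {Φ f, Φ s}) h2 (Ideal.subset_span (by simp))
      rw [Ideal.span_le, Set.pair_subset_iff]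
      refine ⟨hP, ?_⟩
      have := Ideal.sub_mem _ (Ideal.subset_span (by simp : Φ s ∈ ({Φ f, Φ s} : Set _)))
        (Ideal.mem_of_dvd (Ideal.span {Φ f, Φ s}) hr hP)
      simpa using this
    · have hP : (P : PowerSeries (PowerSeries K)) ∈ Ideal.span
        {(P : PowerSeries (PowerSeries K)), (r : PowerSeries (PowerSeries K))} :=
        Ideal.subset_span (by simp)
      rw [Ideal.span_le, Set.pair_subset_iff]
      refine ⟨Ideal.mem_of_dvd _ h1 hP, ?_⟩
      have := Ideal.add_mem _ (Ideal.mem_of_dvd _ hr hP) (Ideal.subset_span (by simp :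
        (r : PowerSeries (PowerSeries K)) ∈ ({(P : PowerSeries (PowerSeries K)),
          (r : PowerSeries (PowerSeries K))} : Set _)))
      simpa using this
  exact congrArg _ (Ideal.quotientEquivAlg _ _ Φ hI).toLinearEquiv.rank_eq

theorem IsEquation.semigroup_eq (h : IsEquation Φ f P) :
    semigroup f = valueSet (branchVal P h.isDistinguishedAt.monic h.irreducible) := by
  ext n
  constructor
  · rintro ⟨s, hs, hn⟩
    obtain ⟨r, hr⟩ := exists_dvd_sub_coe h.isDistinguishedAt (Φ s)
    exact ⟨r, by rw [← h.intersectionNumber_eq hr hs, hn]⟩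
  · rintro ⟨r, hr⟩
    have hd : (P : PowerSeries (PowerSeries K)) ∣
      Φ (Φ.symm (r : PowerSeries (PowerSeries K))) - r := by simp
    have hs : ¬ f ∣ Φ.symm (r : PowerSeries (PowerSeries K)) := by
      rw [h.dvd_iff hd, ← branchVal_eq_top_iff h.isDistinguishedAt.monic h.irreducible, hr]
      exact ENat.natCast_ne_top n
    exact ⟨_, hs, by rw [h.intersectionNumber_eq hd hs, hr]⟩

end Equation

/-! ### Transversal coordinates -/

section Coordinates

variable {K : Type*} [Field K]

/-- Coordinates which preserve the order of power series. -/
structure IsCoord (Φ : Series K ≃ₐ[K] PowerSeries (PowerSeries K)) : Prop where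
  le_order_iff : ∀ (h : Series K) (n : ℕ), (n : ℕ∞) ≤ MvPowerSeries.order h ↔
    ∀ i j, i + j < n → PowerSeries.coeff i (PowerSeries.coeff j (Φ h)) = 0

/-- The isomorphism of `K[[x, y]]` with `K[[x]][[y]]`. -/
def iterEquiv (K : Type*) [Field K] : Series K ≃ₐ[K] PowerSeries (PowerSeries K) :=
  (MvPowerSeries.renameEquiv K ((finSuccEquiv 1).trans
    (Equiv.optionCongr (Equiv.ofUnique (Fin 1) Unit)))).trans
    (MvPowerSeries.optionEquivLeft Unit K)

theorem coeff_coeff_iterEquiv (h : Series K) (i j : ℕ) :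
    PowerSeries.coeff i (PowerSeries.coeff j (iterEquiv K h)) =
      MvPowerSeries.coeff (Finsupp.single 0 j + Finsupp.single 1 i) h := by
  have h1 := MvPowerSeries.coeff_coeff_optionEquivLeft (MvPowerSeries.rename ((finSuccEquiv 1).trans
    (Equiv.optionCongr (Equiv.ofUnique (Fin 1) Unit))) h) j (Finsupp.single () i)
  refine h1.trans ?_
  rw [← MvPowerSeries.coeff_embDomain_rename ((finSuccEquiv 1).trans
    (Equiv.optionCongr (Equiv.ofUnique (Fin 1) Unit))).toEmbedding]
  congr 2
  ext o
  rw [Finsupp.embDomain_eq_mapDomain]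
  cases o with
  | none => simp [Finsupp.mapDomain_add]
  | some u =>
    have h2 : (finSuccEquiv 1) 1 = some 0 := rfl
    simp [Finsupp.mapDomain_add, h2]

theorem finsupp_fin_two (d : Fin 2 →₀ ℕ) : d = Finsupp.single 0 (d 0) + Finsupp.single 1 (d 1) := by
  ext i; fin_cases i <;> simp

theorem isCoord_iterEquiv : IsCoord (iterEquiv K) where
  le_order_iff h n := by
    constructor
    · intro hn i j hij
      rw [coeff_coeff_iterEquiv]
      apply MvPowerSeries.coeff_of_lt_order
      refine lt_of_lt_of_le ?_ hn
      simp only [map_add, Finsupp.degree_single]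
      exact_mod_cast (by omega : j + i < n)
    · intro hc
      apply MvPowerSeries.nat_le_order
      intro d hd
      rw [finsupp_fin_two d, ← coeff_coeff_iterEquiv]
      apply hc
      rw [finsupp_fin_two d] at hd
      simp only [map_add, Finsupp.degree_single] at hd
      omega

/-- The images of the variables under the shear `x ↦ x + t y`. -/
def shearVars (t : K) : Fin 2 → Series K :=
  ![MvPowerSeries.X 0, MvPowerSeries.X 1 + MvPowerSeries.C t * MvPowerSeries.X 0]

theorem constantCoeff_shearVars (t : K) (s : Fin 2) :
    MvPowerSeries.constantCoeff (shearVars t s) = 0 := by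
  fin_cases s <;> simp [shearVars]

theorem hasSubst_shearVars (t : K) : MvPowerSeries.HasSubst (shearVars t) :=
  MvPowerSeries.hasSubst_of_constantCoeff_zero (constantCoeff_shearVars t)

/-- The substitution `x ↦ x + t y`. -/
def shearHom (t : K) : Series K →ₐ[K] Series K :=
  MvPowerSeries.substAlgHom (hasSubst_shearVars t)

theorem shearHom_comp_neg (t : K) (h : Series K) : shearHom t (shearHom (-t) h) = h := by
  rw [shearHom, shearHom, MvPowerSeries.coe_substAlgHom, MvPowerSeries.coe_substAlgHom,
    MvPowerSeries.subst_comp_subst_apply (hasSubst_shearVars (-t)) (hasSubst_shearVars t)]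
  have : (fun s => MvPowerSeries.subst (shearVars t) (shearVars (-t) s)) =
      (MvPowerSeries.X : Fin 2 → Series K) := by
    funext s
    have hX (i : Fin 2) := MvPowerSeries.subst_X (R := K) (hasSubst_shearVars t) i
    have hC (a : K) : MvPowerSeries.subst (shearVars t) (MvPowerSeries.C a : Series K) =
      MvPowerSeries.C a := MvPowerSeries.subst_C _
    fin_cases s
    · simpa [shearVars] using hX 0
    · simp only [shearVars, Fin.mk_one, Matrix.cons_val_one, Matrix.cons_val_fin_one]
      rw [← shearVars, MvPowerSeries.subst_add (hasSubst_shearVars t),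
        MvPowerSeries.subst_mul (hasSubst_shearVars t), hX, hX, hC]
      simp [shearVars]
  rw [this, MvPowerSeries.subst_self]
  rfl

/-- The automorphism `x ↦ x + t y` of `K[[x, y]]`. -/
def shearEquiv (t : K) : Series K ≃ₐ[K] Series K :=
  AlgEquiv.ofAlgHom (shearHom t) (shearHom (-t)) (AlgHom.ext (shearHom_comp_neg t))
    (AlgHom.ext fun h => by simpa using shearHom_comp_neg (-t) h)

theorem le_order_shearHom (t : K) (h : Series K) :
    MvPowerSeries.order h ≤ MvPowerSeries.order (shearHom t h) := by
  have h1 := MvPowerSeries.le_order_subst (hasSubst_shearVars t) h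
  rw [← MvPowerSeries.coe_substAlgHom (hasSubst_shearVars t)] at h1
  refine le_trans ?_ h1
  have h2 : (1 : ℕ∞) ≤ ⨅ i, (shearVars t i).order :=
    le_iInf fun i => MvPowerSeries.one_le_order_iff_constCoeff_eq_zero.2
      (constantCoeff_shearVars t i)
  calc MvPowerSeries.order h = 1 * MvPowerSeries.order h := (one_mul _).symm
    _ ≤ _ := mul_le_mul_left h2 _

theorem order_shearEquiv (t : K) (h : Series K) :
    MvPowerSeries.order (shearEquiv t h) = MvPowerSeries.order h := by
  refine le_antisymm ?_ (le_order_shearHom t h)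
  have := le_order_shearHom (-t) (shearHom t h)
  have h2 := shearHom_comp_neg (-t) h
  rw [neg_neg] at h2
  rwa [h2] at this

theorem isCoord_shear (t : K) : IsCoord ((shearEquiv t).trans (iterEquiv K)) where
  le_order_iff h n := by
    rw [← order_shearEquiv t h]
    exact isCoord_iterEquiv.le_order_iff _ _

/-- The initial form of `h`, evaluated at `(t, 1)`. -/
def initialPoly (h : Series K) (N : ℕ) : Polynomial K :=
  ∑ j ∈ Finset.range (N + 1),
    C (MvPowerSeries.coeff (Finsupp.single 0 (N - j) + Finsupp.single 1 j) h) * X ^ j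

theorem initialPoly_ne_zero {h : Series K} {N : ℕ} (hN : MvPowerSeries.order h = N) :
    initialPoly h N ≠ 0 := by
  obtain ⟨⟨d, hd, hdN⟩, -⟩ := MvPowerSeries.order_eq_nat.1 hN
  intro h0
  apply hd
  have h1 := congrArg (Polynomial.coeff · (d 1)) h0
  simp only [initialPoly, Polynomial.finsetSum_coeff, Polynomial.coeff_C_mul_X_pow,
    Polynomial.coeff_zero] at h1
  rw [finsupp_fin_two d] at hdN
  simp only [map_add, Finsupp.degree_single] at hdN
  rw [Finset.sum_ite_eq, if_pos (Finset.mem_range.2 (by omega)),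
    show N - d 1 = d 0 by omega, ← finsupp_fin_two d] at h1
  exact h1

/-- Only the form `p` of degree `N` matters, since the remainder has order above `N`, which a shear
preserves. Setting `x = 0` after `x ↦ x + t y` evaluates that form at `(t, 1)`. -/
theorem coeff_shear (t : K) {h : Series K} {N : ℕ} (hN : (N : ℕ∞) ≤ MvPowerSeries.order h) :
    PowerSeries.coeff 0 (PowerSeries.coeff N ((shearEquiv t).trans (iterEquiv K) h)) =
      (initialPoly h N).eval t := by
  let p : Series K := ∑ j ∈ Finset.range (N + 1), MvPowerSeries.monomial
    (Finsupp.single 0 (N - j) + Finsupp.single 1 j)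
    (MvPowerSeries.coeff (Finsupp.single 0 (N - j) + Finsupp.single 1 j) h)
  have hp : (((N + 1 : ℕ)) : ℕ∞) ≤ MvPowerSeries.order (h - p) := by
    apply MvPowerSeries.nat_le_order
    intro d hd
    have hdeg : Finsupp.degree d = d 0 + d 1 := by
      conv_lhs => rw [finsupp_fin_two d]
      simp only [map_add, Finsupp.degree_single]
    rw [map_sub, sub_eq_zero, map_sum]
    simp only [MvPowerSeries.coeff_monomial]
    rcases Nat.lt_succ_iff_lt_or_eq.1 hd with hlt | heq
    · rw [MvPowerSeries.coeff_of_lt_order (lt_of_lt_of_le (by exact_mod_cast hlt) hN), eq_comm]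
      refine Finset.sum_eq_zero fun j hj => if_neg fun hdj => ?_
      have h0 := DFunLike.congr_fun hdj 0
      have h1 := DFunLike.congr_fun hdj 1
      simp at h0 h1
      have := Finset.mem_range.1 hj
      omega
    · rw [Finset.sum_eq_single (d 1)]
      · rw [show N - d 1 = d 0 by omega, ← finsupp_fin_two d, if_pos rfl]
      · intro j _ hj
        refine if_neg fun hdj => hj ?_
        have h1 := DFunLike.congr_fun hdj 1
        simpa using h1.symm
      · intro hn
        exact absurd (Finset.mem_range.2 (by omega)) hn
  have hcoef : PowerSeries.coeff 0 (PowerSeries.coeff N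
      ((shearEquiv t).trans (iterEquiv K) (h - p))) = 0 :=
    (isCoord_shear t).le_order_iff _ _ |>.1 hp 0 N (by omega)
  rw [map_sub, map_sub, map_sub, sub_eq_zero] at hcoef
  rw [hcoef]
  -- Restriction to `x = 0`. The variable of index 0 plays the role of `y`, that of index 1 the role
  -- of `x`.
  let ev : Series K →+* PowerSeries K := (PowerSeries.map (PowerSeries.constantCoeff (R := K))).comp
    (iterEquiv K : Series K →+* PowerSeries (PowerSeries K))
  have hev (s : Series K) (n : ℕ) : PowerSeries.coeff n (ev s) =
      PowerSeries.coeff 0 (PowerSeries.coeff n (iterEquiv K s)) := by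
    simp [ev]
  have hev' (s : Series K) (n : ℕ) : PowerSeries.coeff n (ev s) =
      MvPowerSeries.coeff (Finsupp.single 0 n) s := by
    rw [hev, coeff_coeff_iterEquiv]; simp
  have hev0 : ev (MvPowerSeries.X 0) = PowerSeries.X := by
    ext n
    rw [hev', MvPowerSeries.coeff_X, PowerSeries.coeff_X]
    by_cases hn : n = 1
    · rw [if_pos hn, if_pos (by rw [hn])]
    · rw [if_neg hn, if_neg fun h => hn (by simpa using DFunLike.congr_fun h 0)]
  have hev1 : ev (MvPowerSeries.X 1) = 0 := by
    ext n
    rw [hev', MvPowerSeries.coeff_X, map_zero]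
    refine if_neg fun h => ?_
    simpa using DFunLike.congr_fun h 1
  have hevC (a : K) : ev (MvPowerSeries.C a) = PowerSeries.C a := by
    ext n
    rw [hev', MvPowerSeries.coeff_C, PowerSeries.coeff_C]
    by_cases hn : n = 0
    · rw [if_pos hn, if_pos (by rw [hn, Finsupp.single_zero])]
    · rw [if_neg hn, if_neg (by rwa [Finsupp.single_eq_zero])]
  change PowerSeries.coeff 0 (PowerSeries.coeff N (iterEquiv K (shearHom t p))) = _
  rw [← hev]
  have hm (i j : ℕ) (a : K) : ev (shearHom t (MvPowerSeries.monomial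
      (Finsupp.single 0 i + Finsupp.single 1 j) a)) =
      PowerSeries.C (a * t ^ j) * PowerSeries.X ^ (i + j) := by
    have : (MvPowerSeries.monomial (Finsupp.single (0 : Fin 2) i + Finsupp.single 1 j) a :
        Series K) = algebraMap K (Series K) a * MvPowerSeries.X 0 ^ i * MvPowerSeries.X 1 ^ j := by
      rw [MvPowerSeries.X_pow_eq, MvPowerSeries.X_pow_eq, MvPowerSeries.algebraMap_apply,
        ← MvPowerSeries.monomial_zero_eq_C_apply, MvPowerSeries.monomial_mul_monomial,
        MvPowerSeries.monomial_mul_monomial]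
      simp
    rw [this, map_mul (shearHom t), map_mul (shearHom t), map_pow, map_pow, AlgHom.commutes,
      shearHom,
      MvPowerSeries.substAlgHom_X, MvPowerSeries.substAlgHom_X]
    simp only [shearVars, Matrix.cons_val_zero, Matrix.cons_val_one, Matrix.cons_val_fin_one,
      map_mul, map_pow, map_add, hev0, hev1, hevC, MvPowerSeries.algebraMap_apply,
      Algebra.algebraMap_self_apply, zero_add]
    ring
  simp only [p, map_sum, hm, initialPoly, Polynomial.eval_finsetSum, Polynomial.eval_mul,
    Polynomial.eval_C, Polynomial.eval_pow, Polynomial.eval_X]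
  refine Finset.sum_congr rfl fun q hq => ?_
  rw [Nat.sub_add_cancel (Nat.lt_succ_iff.1 (Finset.mem_range.1 hq)),
    PowerSeries.coeff_C_mul_X_pow, if_pos rfl]

/-- There are coordinates transversal to two given series. -/
theorem exists_isCoord [Infinite K] {f h : Series K} {N M : ℕ} (hN : MvPowerSeries.order f = N)
    (hM : MvPowerSeries.order h = M) : ∃ Φ : Series K ≃ₐ[K] PowerSeries (PowerSeries K),
      IsCoord Φ ∧ PowerSeries.coeff 0 (PowerSeries.coeff N (Φ f)) ≠ 0 ∧
        PowerSeries.coeff 0 (PowerSeries.coeff M (Φ h)) ≠ 0 := by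
  classical
  obtain ⟨t, ht⟩ := Infinite.exists_notMem_finset (initialPoly f N * initialPoly h M).roots.toFinset
  have hne := mul_ne_zero (initialPoly_ne_zero hN) (initialPoly_ne_zero hM)
  rw [Multiset.mem_toFinset, Polynomial.mem_roots hne, Polynomial.IsRoot, Polynomial.eval_mul,
    mul_eq_zero, not_or] at ht
  refine ⟨_, isCoord_shear t, ?_, ?_⟩
  · rw [coeff_shear t hN.ge]; exact ht.1
  · rw [coeff_shear t hM.ge]; exact ht.2

end Coordinates

/-! ### Consequences of transversality -/

section Transversal

variable {K : Type*} [Field K]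

/-- If `y` had value `n < N`, then each term `a_i y ^ i` of `P` with `i < N` would have value at
least `N (N - i) + i n > N n`, because `ord a_i ≥ N - i`. But their sum is `-y ^ N` modulo `P`, of
value `N n`. -/
theorem le_branchVal_X {P : Polynomial (PowerSeries K)} (hP : P.Monic) (hirr : Irreducible P)
    (hlow : ∀ i j, i + j < P.natDegree → PowerSeries.coeff i (P.coeff j) = 0) :
    (P.natDegree : ℕ∞) ≤ branchVal P hP hirr X := by
  set ν := branchVal P hP hirr with hν
  by_contra! hlt
  obtain ⟨n, hn⟩ := ENat.ne_top_iff_exists.1 (hlt.trans_le le_top).ne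
  rw [← hn] at hlt
  have hnN : n < P.natDegree := by exact_mod_cast hlt
  have hsum : ((P.natDegree * n : ℕ) : ℕ∞) <
      ν (∑ i ∈ Finset.range P.natDegree, C (P.coeff i) * X ^ i) := by
    refine AddValuation.map_lt_sum ν (ENat.natCast_ne_top _) fun i hi => ?_
    have hi := Finset.mem_range.1 hi
    have ho : ((P.natDegree - i : ℕ) : ℕ∞) ≤ (P.coeff i).order :=
      PowerSeries.nat_le_order _ _ fun j hj => hlow j i (by omega)
    rw [AddValuation.map_mul, AddValuation.map_pow, hν, branchVal_C, ← hν, ← hn]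
    have h1 : ((P.natDegree * n : ℕ) : ℕ∞) <
        ((P.natDegree * (P.natDegree - i) + i * n : ℕ) : ℕ∞) := by
      obtain ⟨c, hc⟩ := Nat.exists_eq_add_of_lt hi
      have h2 : P.natDegree - i = c + 1 := by omega
      rw [h2]
      have : P.natDegree * n < P.natDegree * (c + 1) + i * n := by
        have : (i + (c + 1)) * n < P.natDegree * (c + 1) + i * n := by nlinarith
        rwa [← add_assoc, ← hc] at this
      exact_mod_cast this
    refine h1.trans_le ?_
    rw [nsmul_eq_mul, nsmul_eq_mul, Nat.cast_add, Nat.cast_mul, Nat.cast_mul]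
    gcongr
  have hX : (X : Polynomial (PowerSeries K)) ^ P.natDegree =
      P - ∑ i ∈ Finset.range P.natDegree, C (P.coeff i) * X ^ i := by
    rw [eq_sub_iff_add_eq]
    exact hP.as_sum.symm
  have h3 : ν (X ^ P.natDegree) = ((P.natDegree * n : ℕ) : ℕ∞) := by
    rw [AddValuation.map_pow, ← hn, nsmul_eq_mul, Nat.cast_mul]
  have h4 : ν P = ⊤ := (branchVal_eq_top_iff hP hirr P).2 dvd_rfl
  have h5 := AddValuation.map_sub ν P (∑ i ∈ Finset.range P.natDegree, C (P.coeff i) * X ^ i)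
  rw [← hX, h3, h4, min_eq_right le_top] at h5
  exact absurd hsum h5.not_gt

/-- Both `x` and `y` have value at least `N`, while a unit constant term has value 0. So `N` is the
least positive value. -/
theorem branchVal_dichotomy {P : Polynomial (PowerSeries K)} {hP : P.Monic}
    {hirr : Irreducible P} (hX : (P.natDegree : ℕ∞) ≤ branchVal P hP hirr X)
    (r : Polynomial (PowerSeries K)) :
    branchVal P hP hirr r = 0 ∨
      (PowerSeries.constantCoeff (r.coeff 0) = 0 ∧ (P.natDegree : ℕ∞) ≤ branchVal P hP hirr r) := by
  have hpos : 0 < P.natDegree := hP.natDegree_pos_of_not_isUnit hirr.not_isUnit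
  have h1 : (P.natDegree : ℕ∞) ≤ branchVal P hP hirr (r.divX * X) := by
    rw [AddValuation.map_mul]
    exact hX.trans le_add_self
  have h2 := Polynomial.divX_mul_X_add r
  by_cases h0 : PowerSeries.constantCoeff (r.coeff 0) = 0
  · refine Or.inr ⟨h0, ?_⟩
    rw [← h2]
    refine le_trans (le_min h1 ?_) (AddValuation.map_add _ _ _)
    rw [branchVal_C, nsmul_eq_mul]
    have : (1 : ℕ∞) ≤ (r.coeff 0).order := PowerSeries.one_le_order_iff_constCoeff_eq_zero.2 h0
    calc (P.natDegree : ℕ∞) = P.natDegree * 1 := (mul_one _).symm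
      _ ≤ _ := by gcongr
  · left
    have h3 : branchVal P hP hirr (C (r.coeff 0)) = 0 := by
      rw [branchVal_C, PowerSeries.order_zero_of_unit
        (PowerSeries.isUnit_iff_constantCoeff.2 (IsUnit.mk0 _ h0)), nsmul_zero]
    rw [← h2, AddValuation.map_add_eq_of_lt_right, h3]
    rw [h3]
    exact lt_of_lt_of_le (by exact_mod_cast hpos) h1

theorem IsMinimalGenerators.zero_eq_natDegree {P : Polynomial (PowerSeries K)} {hP : P.Monic}
    {hirr : Irreducible P} (hX : (P.natDegree : ℕ∞) ≤ branchVal P hP hirr X) {g : ℕ} {v : ℕ → ℕ}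
    (hv : IsMinimalGenerators (valueSet (branchVal P hP hirr)) g v) : v 0 = P.natDegree := by
  have hpos : 0 < P.natDegree := hP.natDegree_pos_of_not_isUnit hirr.not_isUnit
  refine hv.isLeast_zero.unique ⟨⟨⟨C PowerSeries.X, branchVal_C_X hP hirr⟩, hpos.ne'⟩, ?_⟩
  rintro n ⟨⟨r, hr⟩, hn0⟩
  rcases branchVal_dichotomy hX r with h | ⟨-, h⟩
  · rw [hr] at h
    exact absurd (by exact_mod_cast h) hn0
  · rw [hr] at h
    exact_mod_cast h

theorem IsMinimalGenerators.zero_le {S : Set ℕ} {g : ℕ} {v : ℕ → ℕ}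
    (hv : IsMinimalGenerators S g v) {i : ℕ} (hi : i ≤ g) : v 0 ≤ v i := by
  rcases Nat.eq_zero_or_pos i with rfl | h0
  · exact le_rfl
  · have h := (hv.isLeast i h0 hi).1
    exact hv.isLeast_zero.2 ⟨h.1, fun h1 => h.2 (by
      rw [Set.mem_singleton_iff.1 h1]; exact zero_mem _)⟩

/-- A branch has a distinguished equation in each system of transversal coordinates. -/
theorem exists_isEquation {Φ : Series K ≃ₐ[K] PowerSeries (PowerSeries K)} (hΦ : IsCoord Φ)
    {f : Series K} (hf : Irreducible f) {N : ℕ} (hN : MvPowerSeries.order f = N)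
    (hc : PowerSeries.coeff 0 (PowerSeries.coeff N (Φ f)) ≠ 0) :
    ∃ (P : Polynomial (PowerSeries K)) (h : IsEquation Φ f P), P.natDegree = N ∧
      (P.natDegree : ℕ∞) ≤ branchVal P h.isDistinguishedAt.monic h.irreducible X := by
  obtain ⟨P, U, hP, hU, hPU, hd⟩ := exists_distinguished (Q := Φ f) (n := N) (by simpa using hc)
    (fun i hi => by simpa using (hΦ.le_order_iff f N).1 hN.ge 0 i (by omega))
  have hass : Associated (P : PowerSeries (PowerSeries K)) (Φ f) := by
    rw [hPU]
    exact associated_mul_unit_right _ _ hU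
  have hirr : Irreducible P := irreducible_of_irreducible_coe hP
    (hass.irreducible_iff.2 ((MulEquiv.irreducible_iff Φ).2 hf))
  refine ⟨P, ⟨hP, hirr, hass⟩, hd, le_branchVal_X _ _ fun i j hij => ?_⟩
  obtain ⟨s, hs⟩ : f ∣ Φ.symm (P : PowerSeries (PowerSeries K)) := by
    rw [← map_dvd_iff Φ, AlgEquiv.apply_symm_apply]
    exact hass.symm.dvd
  have h1 : ((P.natDegree : ℕ) : ℕ∞) ≤
      MvPowerSeries.order (Φ.symm (P : PowerSeries (PowerSeries K))) := by
    rw [hd, hs, ← hN]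
    exact le_self_add.trans MvPowerSeries.le_order_mul
  simpa using (hΦ.le_order_iff _ _).1 h1 i j hij

theorem exists_order_eq {f : Series K} (hf : Irreducible f) :
    ∃ N : ℕ, MvPowerSeries.order f = N :=
  (ENat.ne_top_iff_exists.1 fun h => hf.ne_zero (MvPowerSeries.order_eq_top_iff.1 h)).imp
    fun _ h => h.symm

theorem intersectionNumber_congr {f s t : Series K} (h : Associated s t) :
    intersectionNumber f s = intersectionNumber f t := by
  rw [intersectionNumber, intersectionNumber, Ideal.span_insert, Ideal.span_insert,
    le_antisymm (Ideal.span_singleton_le_span_singleton.2 h.symm.dvd)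
      (Ideal.span_singleton_le_span_singleton.2 h.dvd)]

theorem branchVal_comm {P Q : Polynomial (PowerSeries K)} (hP : P.Monic) (hQ : Q.Monic)
    (hPi : Irreducible P) (hQi : Irreducible Q) :
    branchVal P hP hPi Q = branchVal Q hQ hQi P := by
  by_cases hd : P ∣ Q
  · obtain rfl := Polynomial.eq_of_monic_of_associated hP hQ (hPi.associated_of_dvd hQi hd)
    rfl
  · have hd' : ¬ Q ∣ P := fun h => hd (hQi.associated_of_dvd hPi h).symm.dvd
    rw [← toENat_rank_quotient_eq_branchVal hP hPi hd,
      ← toENat_rank_quotient_eq_branchVal hQ hQi hd', Set.pair_comm]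

end Transversal

/-! ### Transfer of key polynomials between branches -/

section Comparison

variable {K : Type*} [Field K] {ν : AddValuation (Polynomial (PowerSeries K)) ℕ∞} {N k : ℕ}
  {w : ℕ → ℕ} {φ : ℕ → Polynomial (PowerSeries K)}

theorem KeySeq.congr (h : KeySeq ν N k w φ) {v : ℕ → ℕ} (hv : ∀ i ≤ k, v i = w i) :
    KeySeq ν N k v φ := by
  have he (i : ℕ) (hi : i ≤ k) : gcdUpTo v i = gcdUpTo w i :=
    gcdUpTo_congr fun j hj => hv j (by omega)
  refine ⟨by rw [hv 0 (by omega), h.zero], h.monic, fun i hi => ?_, fun i hi => ?_, fun i hi => ?_,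
    fun i hi => ?_⟩
  · rw [he i hi.le, h.natDegree i hi]
  · rw [hv _ hi, h.map i hi]
  · rw [he i hi.le, hv _ hi]; exact h.not_dvd i hi
  · rw [he i (by omega), he (i + 1) hi.le, hv _ hi.le, hv (i + 2) hi]; exact h.growth i hi

theorem KeySeq.growth_le (h : KeySeq ν N k w φ) {i j : ℕ} (hij : i ≤ j) (hj : j < k) :
    gcdUpTo w i * w (i + 1) ≤ gcdUpTo w j * w (j + 1) := by
  induction j, hij using Nat.le_induction with
  | base => exact le_rfl
  | succ j hij ih => exact (ih (by omega)).trans (h.growth j hj).le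

/-- A complete key sequence gives an initial part of the generators; being complete, it already
generates all values and leaves no room for a further one. -/
theorem exists_keySeq_of_generators (hν : IsBranchVal ν N) {g : ℕ} {v : ℕ → ℕ}
    (hv : IsMinimalGenerators (valueSet ν) g v) (hv0 : v 0 = N) :
    ∃ φ, KeySeq ν N g v φ := by
  obtain ⟨k, w, φ, h, he⟩ := exists_keySeq hν
  obtain ⟨hkg, hvw⟩ := h.eq_generators hν hv hv0
  obtain rfl : k = g := by
    by_contra hne
    have h1 := (hv.isLeast (k + 1) (by omega) (by omega)).1
    apply h1.2
    have hI : Set.Iio (k + 1) = Set.Iic k := by ext; simp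
    have himg : v '' Set.Iic k = w '' Set.Iic k := Set.image_congr hvw
    rw [hI, himg, ← h.valueSet_eq hν he]
    exact h1.1
  exact ⟨φ, h.congr hvw⟩

/-- If `Q` has a high contact with `P`, the key polynomials of `P` are key polynomials of `Q`. -/
theorem KeySeq.transfer_branchVal [IsAlgClosed K] {P Q : Polynomial (PowerSeries K)} {hP : P.Monic}
    {hPi : Irreducible P} (h : KeySeq (branchVal P hP hPi) P.natDegree k w φ) (hQ : Q.Monic)
    (hQi : Irreducible Q)
    (hlt : ∀ i < k, ((gcdUpTo w i * w (i + 1) * Q.natDegree : ℕ) : ℕ∞) <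
      branchVal P hP hPi Q * P.natDegree) :
    ∃ w', KeySeq (branchVal Q hQ hQi) Q.natDegree k w' φ ∧
      ∀ i ≤ k, w' i * P.natDegree = w i * Q.natDegree := by
  have hν := isBranchVal_branchVal hP hPi
  refine h.transfer hν.pos (isBranchVal_branchVal hQ hQi).pos fun i hi => ?_
  refine branchVal_mul_natDegree_eq hP hQ (h.monic i hi) hPi hQi (h.irreducible hν hi) ?_
  rw [← branchVal_comm hP (h.monic i hi) hPi, ← branchVal_comm hP hQ hPi, h.map i hi]
  by_contra! hle
  refine (hlt i hi).not_ge ?_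
  rw [nsmul_eq_mul, nsmul_eq_mul] at hle
  calc branchVal P hP hPi Q * P.natDegree
      = gcdUpTo w i * ((φ i).natDegree * branchVal P hP hPi Q) := by
        rw [← h.natDegree i hi]; push_cast; ring
    _ ≤ gcdUpTo w i * (Q.natDegree * (w (i + 1) : ℕ∞)) := by gcongr
    _ = _ := by push_cast; ring

end Comparison

/-! ### The two inequalities -/

section Main

variable {K : Type*} [Field K]

theorem natCast_div_le_natCast_div {a b c d : ℕ} (hb : b ≠ 0) (hd : d ≠ 0)
    (h : a * d ≤ c * b) : (a : ENNReal) / b ≤ (c : ENNReal) / d := by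
  have hb' : (b : ENNReal) ≠ 0 := by exact_mod_cast hb
  have hd' : (d : ENNReal) ≠ 0 := by exact_mod_cast hd
  rw [ENNReal.div_le_iff hb' (ENNReal.natCast_ne_top b), ENNReal.mul_comm_div,
    ← mul_div_assoc, ENNReal.le_div_iff_mul_le (Or.inl hd') (Or.inl (ENNReal.natCast_ne_top d))]
  exact_mod_cast h

theorem length_zariskiPairs (g : ℕ) (v : ℕ → ℕ) : (zariskiPairs g v).length = g := by
  simp [zariskiPairs]

theorem contact_eq {f s : Series K} {N M I : ℕ} (hN : MvPowerSeries.order f = N)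
    (hM : MvPowerSeries.order s = M) (hI : intersectionNumber f s = I) :
    contact f s = (I : ENNReal) / ((N * M : ℕ) : ENNReal) := by
  rw [contact, multiplicity, multiplicity, hN, hM, hI]
  simp

variable [IsAlgClosed K] {f : Series K} {g : ℕ} {v : ℕ → ℕ} {k : ℕ}

theorem contact_le (hf : Irreducible f) (hv : IsMinimalGenerators (semigroup f) g v)
    (hk : 1 ≤ k) (hkg : k ≤ g) {s : Series K} (hs : s ∈ branchFamily K k) :
    contact f s ≤ ((gcdUpTo v (k - 1) * v k : ℕ) : ENNReal) / ((v 0 ^ 2 : ℕ) : ENNReal) := by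
  obtain ⟨hsi, g', u, hu, hlen⟩ := hs
  rw [length_zariskiPairs] at hlen
  obtain ⟨j, rfl⟩ : ∃ j, k = j + 1 := ⟨k - 1, by omega⟩
  rw [Nat.add_sub_cancel] at hlen ⊢
  obtain ⟨N, hN⟩ := exists_order_eq hf
  obtain ⟨M, hM⟩ := exists_order_eq hsi
  obtain ⟨Φ, hΦ, hcf, hcs⟩ := exists_isCoord hN hM
  obtain ⟨P, hfP, hPN, hPX⟩ := exists_isEquation hΦ hf hN hcf
  obtain ⟨Q, hsQ, hQM, hQX⟩ := exists_isEquation hΦ hsi hM hcs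
  have hνP := isBranchVal_branchVal hfP.isDistinguishedAt.monic hfP.irreducible
  have hνQ := isBranchVal_branchVal hsQ.isDistinguishedAt.monic hsQ.irreducible
  rw [hfP.semigroup_eq] at hv
  have hv0 := hv.zero_eq_natDegree hPX
  obtain ⟨φ, hφ⟩ := exists_keySeq_of_generators hνP hv hv0
  -- Otherwise `s` is the branch `f` itself, whose `g > j` Zariski pairs are too many. This excludes
  -- infinite contact.
  have hfs : ¬ f ∣ s := by
    intro hd
    have hsP : IsEquation Φ s P := ⟨hfP.isDistinguishedAt, hfP.irreducible,
      hfP.associated.trans ((hf.associated_of_dvd hsi hd).map Φ)⟩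
    rw [hsP.semigroup_eq] at hu
    have := (hφ.eq_generators hνP hu (hu.zero_eq_natDegree hPX)).1
    omega
  rw [hsQ.semigroup_eq] at hu
  have hss : Associated s (Φ.symm (Q : PowerSeries (PowerSeries K))) := by
    have := hsQ.associated.symm.map Φ.symm
    rwa [AlgEquiv.symm_apply_apply] at this
  have hI : intersectionNumber f s =
      branchVal P hfP.isDistinguishedAt.monic hfP.irreducible Q := by
    rw [intersectionNumber_congr hss]
    exact hfP.intersectionNumber_eq (by simp) (by rwa [← hss.dvd_iff_dvd_right])
  -- By growth, a contact exceeding that of `φ j` exceeds those of all `φ i` with `i ≤ j`. Then `Q`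
  -- inherits `j + 1` key polynomials, hence more than `j` Zariski pairs.
  have hle : branchVal P hfP.isDistinguishedAt.monic hfP.irreducible Q * P.natDegree ≤
      ((gcdUpTo v j * v (j + 1) * Q.natDegree : ℕ) : ℕ∞) := by
    by_contra! hlt
    obtain ⟨w', hw', -⟩ := (hφ.mono hkg).transfer_branchVal hsQ.isDistinguishedAt.monic
      hsQ.irreducible fun i hi => lt_of_le_of_lt (by
        exact_mod_cast Nat.mul_le_mul_right _ (hφ.growth_le (Nat.lt_succ_iff.1 hi) hkg)) hlt
    have := (hw'.eq_generators hνQ hu (hu.zero_eq_natDegree hQX)).1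
    omega
  have hfin : branchVal P hfP.isDistinguishedAt.monic hfP.irreducible Q ≠ ⊤ := by
    intro h
    rw [h, ENat.top_mul (by exact_mod_cast hνP.pos.ne')] at hle
    exact ENat.natCast_ne_top _ (top_le_iff.1 hle)
  obtain ⟨I, hIv⟩ := ENat.ne_top_iff_exists.1 hfin
  rw [← hIv] at hI hle
  have hle' : I * P.natDegree ≤ gcdUpTo v j * v (j + 1) * Q.natDegree := by exact_mod_cast hle
  rw [contact_eq hN hM hI, hv0, ← hPN, ← hQM]
  refine natCast_div_le_natCast_div (Nat.mul_pos hνP.pos hνQ.pos).ne' (pow_pos hνP.pos 2).ne' ?_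
  calc I * P.natDegree ^ 2 = I * P.natDegree * P.natDegree := by ring
    _ ≤ gcdUpTo v j * v (j + 1) * Q.natDegree * P.natDegree := Nat.mul_le_mul_right _ hle'
    _ = _ := by ring

theorem exists_le_contact (hf : Irreducible f) (hv : IsMinimalGenerators (semigroup f) g v)
    (hk : 1 ≤ k) (hkg : k ≤ g) : ∃ s ∈ branchFamily K k,
      ((gcdUpTo v (k - 1) * v k : ℕ) : ENNReal) / ((v 0 ^ 2 : ℕ) : ENNReal) ≤ contact f s := by
  obtain ⟨j, rfl⟩ : ∃ j, k = j + 1 := ⟨k - 1, by omega⟩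
  rw [Nat.add_sub_cancel]
  obtain ⟨N, hN⟩ := exists_order_eq hf
  obtain ⟨Φ, hΦ, hcf, -⟩ := exists_isCoord hN hN
  obtain ⟨P, hfP, hPN, hPX⟩ := exists_isEquation hΦ hf hN hcf
  have hν := isBranchVal_branchVal hfP.isDistinguishedAt.monic hfP.irreducible
  rw [hfP.semigroup_eq] at hv
  have hv0 := hv.zero_eq_natDegree hPX
  obtain ⟨φ, hφ⟩ := exists_keySeq_of_generators hν hv hv0
  have hQi : Irreducible (φ j) := hφ.irreducible hν hkg
  have hQm : (φ j).Monic := hφ.monic j hkg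
  have hQd : (φ j).natDegree * gcdUpTo v j = P.natDegree := hφ.natDegree j hkg
  have hνQ := isBranchVal_branchVal hQm hQi
  have hvpos : 0 < v (j + 1) := hν.pos.trans_le (hv0 ▸ hv.zero_le hkg)
  -- The positive value `v (j + 1)` forces `φ j` to vanish at the origin, so it defines a branch.
  have hQ : (φ j).IsDistinguishedAt (IsLocalRing.maximalIdeal (PowerSeries K)) := by
    refine isDistinguishedAt_of_irreducible hQm hQi ?_
    refine ((branchVal_dichotomy hPX (φ j)).resolve_left ?_).1
    rw [hφ.map j hkg]
    exact_mod_cast hvpos.ne'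
  -- For `i < j`, strict growth says that `P` has larger contact with `φ j` than with `φ i`, so the
  -- earlier key polynomials pass to `φ j`.
  obtain ⟨w', hw', hprop⟩ := (hφ.mono (j := j) (by omega)).transfer_branchVal hQm hQi
    fun i hi => by
      rw [hφ.map j hkg, ← Nat.cast_mul, Nat.cast_lt, ← hQd]
      have h1 : gcdUpTo v i * v (i + 1) < gcdUpTo v j * v (j + 1) :=
        (hφ.growth i (by omega)).trans_le (hφ.growth_le (i := i + 1) hi hkg)
      calc _ < gcdUpTo v j * v (j + 1) * (φ j).natDegree :=
            Nat.mul_lt_mul_of_pos_right h1 hνQ.pos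
        _ = _ := by ring
  -- The values scale by `deg (φ j) / N = 1 / gcdUpTo v j`, so the gcd becomes 1 and the transferred
  -- sequence is complete: `φ j` has exactly `j` Zariski pairs.
  have he : gcdUpTo w' j = 1 := by
    refine Nat.eq_of_mul_eq_mul_right hν.pos ?_
    rw [gcdUpTo_mul hprop, one_mul, mul_comm, hQd]
  have hgen := hw'.isMinimalGenerators hνQ he fun i hi => by
    refine Nat.le_of_mul_le_mul_right ?_ hν.pos
    rw [hprop i hi, mul_comm]
    exact Nat.mul_le_mul_right _ (hv0 ▸ hv.zero_le (by omega))
  let s := Φ.symm (φ j : PowerSeries (PowerSeries K))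
  have hΦs : Φ s = (φ j : PowerSeries (PowerSeries K)) := Φ.apply_symm_apply _
  have hs : IsEquation Φ s (φ j) := ⟨hQ, hQi, by rw [hΦs]⟩
  have hsi : Irreducible s := by
    rw [← MulEquiv.irreducible_iff Φ, hΦs]
    exact irreducible_coe hQ hQi.prime
  have hd : (P : PowerSeries (PowerSeries K)) ∣ Φ s - φ j := by rw [hΦs, sub_self]; exact dvd_zero _
  have hI : intersectionNumber f s = (v (j + 1) : ℕ∞) := by
    rw [hfP.intersectionNumber_eq hd, hφ.map j hkg]
    rw [hfP.dvd_iff hd, ← branchVal_eq_top_iff hfP.isDistinguishedAt.monic hfP.irreducible,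
      hφ.map j hkg]
    exact ENat.natCast_ne_top _
  obtain ⟨M, hM⟩ := exists_order_eq hsi
  have hM0 : M ≠ 0 := by
    rintro rfl
    refine hsi.not_isUnit (MvPowerSeries.isUnit_iff_constantCoeff.2 (IsUnit.mk0 _ fun h0 => ?_))
    rw [← MvPowerSeries.one_le_order_iff_constCoeff_eq_zero, hM] at h0
    simp at h0
  -- An upper bound on the multiplicity suffices, since it enters the denominator of the contact. It
  -- comes from the leading coefficient 1 of `φ j`.
  have hMD : M ≤ (φ j).natDegree := by
    by_contra! hlt
    have h1 := (hΦ.le_order_iff s M).1 hM.ge 0 (φ j).natDegree (by omega)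
    rw [hΦs, Polynomial.coeff_coe, hQm.coeff_natDegree] at h1
    simp at h1
  refine ⟨s, ⟨hsi, j, w', by rwa [hs.semigroup_eq], by simp [length_zariskiPairs]⟩, ?_⟩
  rw [contact_eq hN hM hI, hv0, ← hPN]
  refine natCast_div_le_natCast_div (pow_pos hν.pos 2).ne'
    (Nat.mul_pos hν.pos (Nat.pos_of_ne_zero hM0)).ne' ?_
  calc gcdUpTo v j * v (j + 1) * (P.natDegree * M)
      ≤ gcdUpTo v j * v (j + 1) * (P.natDegree * (φ j).natDegree) := by gcongr
    _ = v (j + 1) * (P.natDegree * ((φ j).natDegree * gcdUpTo v j)) := by ring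
    _ = _ := by rw [hQd]; ring

end Main

end PlaneCurve

end

theorem mainTheorem10 {K : Type*} [Field K] [IsAlgClosed K]
    (f : PlaneCurve.Series K) (hf : Irreducible f) (g : ℕ) (v : ℕ → ℕ)
    (hv : PlaneCurve.IsMinimalGenerators (PlaneCurve.semigroup f) g v)
    (k : ℕ) (hk : 1 ≤ k) (hkg : k ≤ g) :
    PlaneCurve.contactExponent k f =
      ((PlaneCurve.gcdUpTo v (k - 1) : ENNReal) * (v k : ENNReal)) / (v 0 : ENNReal) ^ 2 := by
  have h : ((PlaneCurve.gcdUpTo v (k - 1) : ENNReal) * (v k : ENNReal)) / (v 0 : ENNReal) ^ 2 =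
      ((PlaneCurve.gcdUpTo v (k - 1) * v k : ℕ) : ENNReal) / ((v 0 ^ 2 : ℕ) : ENNReal) := by
    push_cast
    rfl
  rw [h]
  apply le_antisymm
  · refine sSup_le ?_
    rintro _ ⟨s, hs, rfl⟩
    exact PlaneCurve.contact_le hf hv hk hkg hs
  · obtain ⟨s, hs, hle⟩ := PlaneCurve.exists_le_contact hf hv hk hkg
    exact hle.trans (le_sSup ⟨s, hs, rfl⟩)
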